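/- All matroids here are finite, and $r$ denotes the rank function. A matroid $M$ is connected if $\emptyset$ and $M$ are the only sets $F\subseteq M$ with $r(F)+r(M\setminus F)=r(M)$; a component of $M$ is an inclusion-wise maximal nonempty set $F\subseteq M$ such that $M|F$ is connected. For a rooted tree $T$, $\|T\|$ denotes its number of edges, and its depth is the length of a longest path from the root to a leaf. A depth-decomposition of $M$ is a pair $(T,f)$ of a rooted tree $T$ and a map $f:M\to V(T)$ such that $r(M)=\|T\|$ and $r(X)\le\|T^*(X)\|$ for every $X\subseteq M$, where $T^*(X)$ is the union of the paths from the root to the vertices in $f(X)$. The branch-depth $\mathrm{bd}(M)$ is the smallest depth of a rooted tree $T$ over all depth-decompositions $(T,f)$ of $M$. Consider the following recursive routine $\mathrm{construct}(M,C,e)$. Its input is a connected matroid $M$, a circuit $C$ of $M$ and a non-loop element $e\in C$; if $M$ has a single element, $C$ and $e$ are irrelevant and may be arbitrary. 0. If $r(M)=0$, return the one-vertex tree, with all elements mapped to the root. 1. If $r(M)=1$, return the one-edge tree, with all elements mapped to the leaf (the non-root vertex). 2. If $r(M)\ge 2$ and $|C|=2$, choose a circuit $C'$ of $M$ with $|C'|\ge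 3$ and $e\in C'$, and return $\mathrm{construct}(M,C',e)$. 3. If $r(M)\ge 2$, $|C|\neq 2$ and $M/e$ is connected, choose $e_1\in C\setminus\{e\}$ and let $(T',f')=\mathrm{construct}(M/e,C\setminus\{e\},e_1)$. Return the tree obtained from $T'$ by adding a new root joined to the root $v'$ of $T'$, with $f(e)=v'$ and $f(x)=f'(x)$ for $x\ne e$. 4. If $r(M)\ge 2$, $|C|\ne 2$ and $M/e$ is not connected, proceed as follows for every component $M_i$ of $M/e$. If $M_i$ contains $C\setminus\{e\}$, choose $e_i\in C\setminus\{e\}$ and let $(T_i,f_i)=\mathrm{construct}((M/e)|M_i,C\setminus\{e\},e_i)$. If $M_i$ is disjoint from $C$, choose a circuit $C_i$ of $M$ with $e\in C_i\subseteq M_i\cup\{e\}$, choose $e_i\in C_i\setminus\{e\}$, and let $(T_i,f_i)=\mathrm{construct}((M/e)|M_i,C_i\setminus\{e\},e_i)$. Identify the roots of all the trees $T_i$ into one vertex $v'$ and add a new root joined to $v'$; return the resulting tree with $f(e)=v'$ and $f(x)=f_i(x)$ for $x\in M_i$. For an arbitrary matroid $M$, the algorithm runs $\mathrm{construct}(M|F,C_F,e_F)$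 for each component $F$ of $M$, with any admissible $C_F$ and $e_F$, and identifies the roots of the resulting trees (obtaining the one-vertex tree if $M$ is empty). **Lemma.** For every finite connected matroid $M$ and every admissible input $(M,C,e)$, the routine $\mathrm{construct}(M,C,e)$ always terminates without getting stuck, whatever choices are made, and every pair $(T,f)$ that it can return is a depth-decomposition of $M$ of depth at most $4^{\mathrm{bd}(M)}$. Likewise, for every finite matroid $M$, connected or not, the algorithm that processes the components of $M$ can return a pair, and every pair $(T,f)$ that it can return is a depth-decomposition of $M$ of depth at most $4^{\mathrm{bd}(M)}$. -/

import Mathlib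

universe u

namespace BranchDepth

/-- A finite rooted tree, given by its parent map: the root is its own parent (by convention),
and every vertex reaches the root by following parents. The edges of the tree are the pairs
`{v, parent v}` with `v` a vertex other than the root. -/
structure Tree where
  V : Type u
  finite : Finite V
  root : V
  parent : V → V
  parent_root : parent root = root
  reaches : ∀ v, ∃ n : ℕ, parent^[n] v = root

namespace Tree

/-- The edge set of the tree. -/
def edges (T : Tree.{u}) : Set (Sym2 T.V) :=
  {ε | ∃ v, v ≠ T.root ∧ ε = s(v, T.parent v)}

/-- The edges of the union of the paths from the root to all vertices in `S`. -/
def rootPathEdges (T : Tree.{u}) (S : Set T.V) : Set (Sym2 T.V) :=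
  {ε | ∃ v ∈ S, ∃ n : ℕ, T.parent^[n] v ≠ T.root ∧
    ε = s(T.parent^[n] v, T.parent (T.parent^[n] v))}

/-- The length of the path from the root to `v`. -/
noncomputable def level (T : Tree.{u}) (v : T.V) : ℕ := sInf {n | T.parent^[n] v = T.root}

/-- The depth of a rooted tree: the length of a longest path starting at the root. -/
noncomputable def depth (T : Tree.{u}) : ℕ := ⨆ v : T.V, T.level v

/-- The one-vertex tree. -/
def single : Tree.{u} where
  V := PUnit
  finite := inferInstance
  root := PUnit.unit
  parent := id
  parent_root := rfl
  reaches _ := ⟨0, rfl⟩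

open Classical in
/-- Add a new vertex `none`, joined to the old root, and make it the root. -/
noncomputable def addRoot (T : Tree.{u}) : Tree.{u} where
  V := Option T.V
  finite := haveI := T.finite; inferInstance
  root := none
  parent o := o.elim none fun v => if v = T.root then none else some (T.parent v)
  parent_root := rfl
  reaches o := by
    rcases o with _ | v
    · exact ⟨0, rfl⟩
    obtain ⟨n, hn⟩ := T.reaches v
    induction n generalizing v with
    | zero => exact ⟨1, by simpa using hn⟩
    | succ n ih =>
      by_cases hv : v = T.root
      · exact ⟨1, by simpa using hv⟩
      · obtain ⟨m, hm⟩ := ih (T.parent v) hn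
        exact ⟨m + 1, by simpa [hv] using hm⟩

open Classical in
/-- The vertex of the glued tree (see `glue`) that comes from the vertex `v` of the `i`-th tree;
`none` is the common root. -/
noncomputable def glueIn {ι : Type u} (T : ι → Tree.{u}) (i : ι) (v : (T i).V) :
    Option (Σ i, {v : (T i).V // v ≠ (T i).root}) :=
  if h : v = (T i).root then none else some ⟨i, v, h⟩

/-- The tree obtained from disjoint copies of the trees `T i` by identifying all their roots
(the one-vertex tree if there are no trees). -/
noncomputable def glue {ι : Type u} [Finite ι] (T : ι → Tree.{u}) : Tree.{u} where
  V := Option (Σ i, {v : (T i).V // v ≠ (T i).root})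
  finite := haveI := fun i => (T i).finite; inferInstance
  root := none
  parent o := o.elim none fun p => glueIn T p.1 ((T p.1).parent p.2.1)
  parent_root := rfl
  reaches o := by
    rcases o with _ | ⟨i, v, hv⟩
    · exact ⟨0, rfl⟩
    obtain ⟨n, hn⟩ := (T i).reaches v
    induction n generalizing v with
    | zero => exact absurd hn hv
    | succ n ih =>
      by_cases hp : (T i).parent v = (T i).root
      · exact ⟨1, by simp [glueIn, hp]⟩
      · obtain ⟨m, hm⟩ := ih ((T i).parent v) hp hn
        exact ⟨m + 1, by simpa [glueIn, hp] using hm⟩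

end Tree

variable {α : Type u}

/-- `(T, f)` is a depth-decomposition of `M`; only the values of `f` on the ground set matter. -/
def IsDepthDecomposition (M : Matroid α) (T : Tree.{u}) (f : α → T.V) : Prop :=
  M.eRank = T.edges.encard ∧
    ∀ X ⊆ M.E, M.eRk X ≤ (T.rootPathEdges (f '' X)).encard

/-- The branch-depth of a (finite) matroid. -/
noncomputable def bd (M : Matroid α) : ℕ :=
  sInf {d | ∃ (T : Tree.{u}) (f : α → T.V), IsDepthDecomposition M T f ∧ T.depth = d}

/-- A matroid is connected if only the empty set and the whole ground set `E` satisfy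
`r(F) + r(E \ F) = r(E)`. -/
def IsConnected (M : Matroid α) : Prop :=
  ∀ F ⊆ M.E, M.eRk F + M.eRk (M.E \ F) = M.eRank → F = ∅ ∨ F = M.E

/-- A component is an inclusion-wise maximal (nonempty) set `F` such that `M|F` is connected. -/
def IsComponent (M : Matroid α) (F : Set α) : Prop :=
  Maximal (fun F => F ⊆ M.E ∧ F.Nonempty ∧ IsConnected (M.restrict F)) F

/-- The type of components of a matroid. -/
abbrev Component (M : Matroid α) : Type u := {F : Set α // IsComponent M F}

/-- The inputs of the routine: a connected matroid, a circuit and a non-loop element of it.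
For a matroid with a single element, which may have no circuit or no non-loop element,
the parameters `C` and `e` are irrelevant and arbitrary. -/
def IsInput (M : Matroid α) (C : Set α) (e : α) : Prop :=
  IsConnected M ∧ ((M.IsCircuit C ∧ e ∈ C ∧ M.IsNonloop e) ∨ M.E.encard = 1)

/-- The routine called with `(M, C, e)` reaches Step 2 and may choose `C'` there. -/
def Step2 (M : Matroid α) (C : Set α) (e : α) (C' : Set α) : Prop :=
  2 ≤ M.eRank ∧ C.encard = 2 ∧ M.IsCircuit C' ∧ 3 ≤ C'.encard ∧ e ∈ C'

/-- The routine called with `(M, C, e)` reaches Step 3 and may choose `e₁` there. -/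
def Step3 (M : Matroid α) (C : Set α) (e e₁ : α) : Prop :=
  2 ≤ M.eRank ∧ C.encard ≠ 2 ∧ IsConnected (M.contract {e}) ∧ e₁ ∈ C \ {e}

/-- The routine called with `(M, C, e)` reaches Steps 4 and 5. -/
def Step45 (M : Matroid α) (C : Set α) (e : α) : Prop :=
  2 ≤ M.eRank ∧ C.encard ≠ 2 ∧ ¬ IsConnected (M.contract {e})

/-- `D` and `g` are possible choices, in Steps 4 and 5 of the routine called with `(M, C, e)`,
of the circuit and the element passed to the recursive call for the component `F` of `M / e`:
either `F` contains `C \ {e}` (Step 4) or `F` is disjoint from `C` (Step 5). -/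
def Choice45 (M : Matroid α) (C : Set α) (e : α) (F : Set α) (D : Set α) (g : α) : Prop :=
  (C \ {e} ⊆ F ∧ D = C \ {e} ∧ g ∈ D) ∨
    (Disjoint F C ∧ ∃ C', M.IsCircuit C' ∧ C' ⊆ insert e F ∧ e ∈ C' ∧ D = C' \ {e} ∧ g ∈ D)

/-- `Construct M C e T f`: the routine, called with `(M, C, e)`, can return `(T, f)`, the
arbitrary choices of the routine being made in some way. -/
inductive Construct : Matroid α → Set α → α → (T : Tree.{u}) → (α → T.V) → Prop
  | step0 (M : Matroid α) (C : Set α) (e : α) (f : α → Tree.single.V)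
      (hr : M.eRank = 0)
      (hf : ∀ x ∈ M.E, f x = Tree.single.root) :
      Construct M C e Tree.single f
  | step1 (M : Matroid α) (C : Set α) (e : α) (f : α → Tree.single.addRoot.V)
      (hr : M.eRank = 1)
      (hf : ∀ x ∈ M.E, f x = some Tree.single.root) :
      Construct M C e Tree.single.addRoot f
  | step2 (M : Matroid α) (C : Set α) (e : α) (C' : Set α) (T : Tree.{u}) (f : α → T.V)
      (hs : Step2 M C e C')
      (hc : Construct M C' e T f) :
      Construct M C e T f
  | step3 (M : Matroid α) (C : Set α) (e e₁ : α) (T' : Tree.{u}) (f' : α → T'.V)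
      (f : α → T'.addRoot.V)
      (hs : Step3 M C e e₁)
      (hc : Construct (M.contract {e}) (C \ {e}) e₁ T' f')
      (hfe : f e = some T'.root)
      (hf : ∀ x ∈ M.E \ {e}, f x = some (f' x)) :
      Construct M C e T'.addRoot f
  | step45 (M : Matroid α) (C : Set α) (e : α) [Finite (Component (M.contract {e}))]
      (D : Component (M.contract {e}) → Set α) (g : Component (M.contract {e}) → α)
      (T : Component (M.contract {e}) → Tree.{u}) (h : ∀ F, α → (T F).V)
      (f : α → (Tree.glue T).addRoot.V)
      (hs : Step45 M C e)
      (hD : ∀ F, Choice45 M C e F.1 (D F) (g F))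
      (hc : ∀ F, Construct ((M.contract {e}).restrict F.1) (D F) (g F) (T F) (h F))
      (hfe : f e = some (Tree.glue T).root)
      (hf : ∀ F, ∀ x ∈ F.1, f x = some (Tree.glueIn T F (h F x))) :
      Construct M C e (Tree.glue T).addRoot f

/-- `Calls s s'`: the routine called with the parameters `s` can, depending on its choices, call
itself recursively with the parameters `s'`. -/
inductive Calls : Matroid α × Set α × α → Matroid α × Set α × α → Prop
  | step2 (M : Matroid α) (C : Set α) (e : α) (C' : Set α) (hs : Step2 M C e C') :
      Calls (M, C, e) (M, C', e)
  | step3 (M : Matroid α) (C : Set α) (e e₁ : α) (hs : Step3 M C e e₁) :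
      Calls (M, C, e) (M.contract {e}, C \ {e}, e₁)
  | step45 (M : Matroid α) (C : Set α) (e : α) (F : Component (M.contract {e}))
      (D : Set α) (g : α) (hs : Step45 M C e) (hD : Choice45 M C e F.1 D g) :
      Calls (M, C, e) ((M.contract {e}).restrict F.1, D, g)

/-- Whatever choices are made, the routine called with `(M, C, e)` runs to completion: no chain of
recursive calls is infinite, and no call made during the execution gets stuck. -/
def AlwaysReturns (M : Matroid α) (C : Set α) (e : α) : Prop :=
  Acc (fun s' s => Calls s s') (M, C, e) ∧
    ∀ s, Relation.ReflTransGen Calls (M, C, e) s →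
      ∃ (T : Tree.{u}) (f : α → T.V), Construct s.1 s.2.1 s.2.2 T f

/-- `ConstructAll M T f`: the algorithm for an arbitrary matroid `M` can return `(T, f)`. It runs
the routine on each component of `M`, with some circuit and some non-loop element of it, and
identifies the roots of the resulting decompositions. -/
inductive ConstructAll : Matroid α → (T : Tree.{u}) → (α → T.V) → Prop
  | mk (M : Matroid α) [Finite (Component M)] (C : Component M → Set α) (e : Component M → α)
      (T : Component M → Tree.{u}) (h : ∀ F, α → (T F).V) (f : α → (Tree.glue T).V)
      (hi : ∀ F, IsInput (M.restrict F.1) (C F) (e F))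
      (hc : ∀ F, Construct (M.restrict F.1) (C F) (e F) (T F) (h F))
      (hf : ∀ F, ∀ x ∈ F.1, f x = Tree.glueIn T F (h F x)) :
      ConstructAll M (Tree.glue T) f

end BranchDepth

/-! Let `n` bound the sizes of all circuits of `M`. The proof combines a bound `n ≤ 2 ^ bd M` with a
bound `n ^ 2` on the depth of every returned tree.

For the first bound, each tree edge gives the set of elements mapped below it. These sets form a
laminar family, and a depth-decomposition says that any `X` meets at least `r(X)` of them.
Discarding innermost sets passes from `M` to a circuit `C`, leaving exactly `|C| - 1` sets. One of
them must contain `C`; after its removal `C` splits into two parts, each satisfying the hypotheses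
of a circuit at depth one less (`card_le_two_pow_of_laminar`). Hence `|C| ≤ 2 ^ d`.

For the second bound, each level of recursion uses up one element of the current circuit, so a tree
deeper than `|C| - 1` needs a change of circuit. Such a change leaves an ear of `C`: an independent
`Q` that is a circuit of `M / C`. The invariant `Construct.earBound` says that the excess depth is
at most `|Q| (n - 2)` for one ear `Q`. Ears lift through contraction, since `M / e / (C \ e) = M /
C`, and at a change of circuit the ear is absorbed into a larger circuit `K` through `e`
(`IsEar.exists_isCircuit_mem`), whose remainder `K \ e` is an ear of the old circuit. As ears have
fewer than `n` elements, the depth never exceeds `n ^ 2`.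

That the output is a depth-decomposition follows from additivity of rank over components and from
the drop of rank by one when a nonloop is contracted. Termination holds because Step 2 is never
taken twice in a row and every other call shrinks the ground set. -/

namespace BranchDepth
-- Sizes, depths and ancestor sets of rooted trees
namespace Tree

attribute [instance] Tree.finite

/-- The non-root vertices on the paths from the root to the vertices in `S`. -/
def ancestors (T : Tree.{u}) (S : Set T.V) : Set T.V :=
  {w | w ≠ T.root ∧ ∃ v ∈ S, ∃ n : ℕ, T.parent^[n] v = w}

/-- The number of edges of a tree, counted as its number of non-root vertices. -/
noncomputable def size (T : Tree.{u}) : ℕ := Nat.card {v : T.V // v ≠ T.root}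

variable (T : Tree.{u})

lemma iterate_parent_root (n : ℕ) : T.parent^[n] T.root = T.root :=
  Function.iterate_fixed T.parent_root n

lemma edge_injOn : Set.InjOn (fun v => s(v, T.parent v)) {v : T.V | v ≠ T.root} := by
  intro v hv w hw h
  rcases Sym2.eq_iff.1 h with h | ⟨h₁, h₂⟩
  · exact h.1
  -- Two vertices that are each other's parent would cycle with period two and never reach the root.
  · have hfix : T.parent^[2] v = v := by simp [h₂, ← h₁]
    obtain ⟨n, hn⟩ := T.reaches v
    have h1 : T.parent^[2 * n] v = v := by
      rw [Function.iterate_mul]; exact Function.iterate_fixed hfix n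
    have h2 : T.parent^[2 * n] v = T.root := by
      rw [two_mul, Function.iterate_add_apply, hn, iterate_parent_root]
    exact absurd (h1.symm.trans h2) hv

lemma encard_edges : T.edges.encard = T.size := by
  have : T.edges = (fun v => s(v, T.parent v)) '' {v : T.V | v ≠ T.root} := by
    ext ε
    simp only [edges, Set.mem_ofPred_eq, Set.mem_image]
    exact ⟨fun ⟨v, h, h'⟩ => ⟨v, h, h'.symm⟩, fun ⟨v, h, h'⟩ => ⟨v, h, h'.symm⟩⟩
  rw [this, T.edge_injOn.encard_image, ← (Set.toFinite _).cast_ncard_eq]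
  rfl

lemma encard_rootPathEdges (S : Set T.V) :
    (T.rootPathEdges S).encard = (T.ancestors S).ncard := by
  have : T.rootPathEdges S = (fun v => s(v, T.parent v)) '' T.ancestors S := by
    ext ε
    simp only [rootPathEdges, ancestors, Set.mem_ofPred_eq, Set.mem_image]
    constructor
    · rintro ⟨v, hv, n, hn, rfl⟩
      exact ⟨_, ⟨hn, v, hv, n, rfl⟩, rfl⟩
    · rintro ⟨w, ⟨hw, v, hv, n, rfl⟩, rfl⟩
      exact ⟨v, hv, n, hw, rfl⟩
  rw [this, (T.edge_injOn.mono fun v hv => hv.1).encard_image,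
    (Set.toFinite _).cast_ncard_eq]

lemma size_add_one : T.size + 1 = Nat.card T.V := by
  rw [← Set.ncard_add_ncard_compl {v : T.V | v ≠ T.root}]
  have : {v : T.V | v ≠ T.root}ᶜ = {T.root} := by ext; simp
  rw [this, Set.ncard_singleton]
  rfl

lemma size_single : single.{u}.size = 0 := by
  have := single.{u}.size_add_one
  have h : Nat.card single.{u}.V = 1 := Nat.card_unique (α := PUnit)
  omega

lemma size_addRoot : T.addRoot.size = T.size + 1 := by
  have h := T.addRoot.size_add_one
  have h' : Nat.card T.addRoot.V = Nat.card T.V + 1 := Finite.card_option (α := T.V)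
  have := T.size_add_one
  omega

lemma size_glue {ι : Type u} [Fintype ι] (T : ι → Tree.{u}) :
    (glue T).size = ∑ i, (T i).size := by
  have h := (glue T).size_add_one
  have h' : Nat.card (glue T).V = Nat.card (Σ i, {v : (T i).V // v ≠ (T i).root}) + 1 :=
    Finite.card_option
  rw [Nat.card_sigma] at h'
  have : (glue T).size = ∑ i, Nat.card {v : (T i).V // v ≠ (T i).root} := by omega
  exact this

lemma addRoot_parent_some {v : T.V} (hv : v ≠ T.root) :
    T.addRoot.parent (some v) = some (T.parent v) := if_neg hv

lemma addRoot_parent_some_root : T.addRoot.parent (some T.root) = T.addRoot.root := if_pos rfl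

lemma addRoot_iterate_of_iterate {v w : T.V} {n : ℕ} (h : T.parent^[n] v = w) :
    ∃ m, T.addRoot.parent^[m] (some v) = some w := by
  induction n generalizing v with
  | zero => exact ⟨0, congrArg some h⟩
  | succ n ih =>
    by_cases hv : v = T.root
    · rw [hv, iterate_parent_root] at h
      exact ⟨0, congrArg some (hv.trans h)⟩
    · obtain ⟨m, hm⟩ := ih (v := T.parent v) h
      exact ⟨m + 1, (congrArg T.addRoot.parent^[m] (T.addRoot_parent_some hv)).trans hm⟩

lemma addRoot_iterate_eq_none {v : T.V} {n : ℕ} (h : T.parent^[n] v = T.root) :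
    T.addRoot.parent^[n + 1] (some v) = T.addRoot.root := by
  induction n generalizing v with
  | zero =>
    have hv : v = T.root := h
    subst hv
    exact T.addRoot_parent_some_root
  | succ n ih =>
    by_cases hv : v = T.root
    · subst hv
      exact (congrArg T.addRoot.parent^[n + 1] T.addRoot_parent_some_root).trans
        (T.addRoot.iterate_parent_root _)
    · exact (congrArg T.addRoot.parent^[n + 1] (T.addRoot_parent_some hv)).trans (ih h)

lemma glueIn_root {ι : Type u} (T : ι → Tree.{u}) (i : ι) : glueIn T i (T i).root = none := by
  simp [glueIn]

lemma glueIn_of_ne {ι : Type u} (T : ι → Tree.{u}) (i : ι) {v : (T i).V} (h : v ≠ (T i).root) :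
    glueIn T i v = some ⟨i, v, h⟩ := by
  simp [glueIn, h]

lemma glue_iterate_glueIn {ι : Type u} [Finite ι] (T : ι → Tree.{u}) (i : ι) (v : (T i).V) (n : ℕ) :
    (glue T).parent^[n] (glueIn T i v) = glueIn T i ((T i).parent^[n] v) := by
  induction n generalizing v with
  | zero => rfl
  | succ n ih =>
    refine Eq.trans (congrArg (glue T).parent^[n] ?_) (ih ((T i).parent v))
    by_cases hv : v = (T i).root
    · rw [hv, (T i).parent_root, glueIn_root]; rfl
    · rw [glueIn_of_ne T i hv]; rfl

lemma iterate_level (v : T.V) : T.parent^[T.level v] v = T.root :=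
  Nat.sInf_mem (s := {n | T.parent^[n] v = T.root}) (T.reaches v)

lemma level_le_of_iterate {v : T.V} {n : ℕ} (h : T.parent^[n] v = T.root) : T.level v ≤ n :=
  Nat.sInf_le h

lemma level_le_depth (v : T.V) : T.level v ≤ T.depth :=
  le_ciSup (f := T.level) (Set.finite_range _).bddAbove v

lemma depth_le {d : ℕ} (h : ∀ v, T.level v ≤ d) : T.depth ≤ d := ciSup_le' h

lemma depth_single : single.{u}.depth = 0 :=
  Nat.le_zero.1 <| depth_le _ fun _ => level_le_of_iterate _ (n := 0) rfl

lemma depth_addRoot_le : T.addRoot.depth ≤ T.depth + 1 := by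
  refine depth_le _ fun o => ?_
  rcases o with _ | v
  · exact (level_le_of_iterate T.addRoot (n := 0) rfl).trans (Nat.zero_le _)
  · exact (T.addRoot.level_le_of_iterate (T.addRoot_iterate_eq_none (T.iterate_level v))).trans
      (Nat.succ_le_succ (T.level_le_depth v))

lemma depth_glue_le {ι : Type u} [Finite ι] (T : ι → Tree.{u}) {d : ℕ}
    (h : ∀ i, (T i).depth ≤ d) : (glue T).depth ≤ d := by
  refine depth_le _ fun o => ?_
  rcases o with _ | ⟨i, v, hv⟩
  · exact (level_le_of_iterate (glue T) (n := 0) rfl).trans (Nat.zero_le _)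
  · refine ((glue T).level_le_of_iterate (n := (T i).level v) ?_).trans
      (((T i).level_le_depth v).trans (h i))
    rw [← glueIn_of_ne T i hv, glue_iterate_glueIn, iterate_level, glueIn_root]
    rfl

open Classical in
lemma ncard_ancestors_singleton_le (v : T.V) : (T.ancestors {v}).ncard ≤ T.depth := by
  refine le_trans ?_ (T.level_le_depth v)
  have : T.ancestors {v} ⊆ ((Finset.range (T.level v)).image fun n => T.parent^[n] v : Set T.V) := by
    rintro w ⟨hw, u, rfl, n, rfl⟩
    rw [Finset.coe_image]
    refine ⟨n, ?_, rfl⟩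
    rw [Finset.coe_range, Set.mem_Iio]
    by_contra! hn
    obtain ⟨k, rfl⟩ := Nat.exists_eq_add_of_le' hn
    rw [Function.iterate_add_apply, iterate_level, iterate_parent_root] at hw
    exact hw rfl
  calc _ ≤ _ := Set.ncard_le_ncard this
    _ ≤ _ := by
      rw [Set.ncard_coe_finset]
      exact Finset.card_image_le.trans (by simp)

lemma ancestors_comparable {v a b : T.V} (ha : a ∈ T.ancestors {v}) (hb : b ∈ T.ancestors {v}) :
    (∃ n, T.parent^[n] a = b) ∨ ∃ n, T.parent^[n] b = a := by
  obtain ⟨-, _, rfl, m, rfl⟩ := ha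
  obtain ⟨-, _, rfl, n, rfl⟩ := hb
  rcases le_total m n with h | h
  · obtain ⟨k, rfl⟩ := Nat.exists_eq_add_of_le' h
    exact .inl ⟨k, by rw [Function.iterate_add_apply]⟩
  · obtain ⟨k, rfl⟩ := Nat.exists_eq_add_of_le' h
    exact .inr ⟨k, by rw [Function.iterate_add_apply]⟩

/-- The gain of one is the old root, which is now a non-root vertex above every old vertex;
nonemptiness of `S` is needed for it to count. -/
lemma ncard_ancestors_addRoot {S : Set T.V} (hS : S.Nonempty) {S' : Set T.addRoot.V}
    (h : some '' S ⊆ S') : (T.ancestors S).ncard + 1 ≤ (T.addRoot.ancestors S').ncard := by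
  have hroot : T.root ∉ T.ancestors S := fun h => h.1 rfl
  rw [← Set.ncard_insert_of_notMem hroot, ← Set.ncard_image_of_injective _ (Option.some_injective _)]
  refine Set.ncard_le_ncard ?_
  rintro _ ⟨w, hw, rfl⟩
  refine ⟨fun h => Option.some_ne_none w h, ?_⟩
  have : ∃ v ∈ S, ∃ n, T.parent^[n] v = w := by
    rcases hw with rfl | hw
    · obtain ⟨v, hv⟩ := hS
      exact ⟨v, hv, T.reaches v⟩
    · exact hw.2
  obtain ⟨v, hv, n, hn⟩ := this
  exact ⟨some v, h ⟨v, hv, rfl⟩, T.addRoot_iterate_of_iterate hn⟩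

lemma sum_ncard_ancestors_le_glue {ι : Type u} [Fintype ι] (T : ι → Tree.{u})
    (S : ∀ i, Set (T i).V) {S' : Set (glue T).V} (h : ∀ i, glueIn T i '' S i ⊆ S') :
    ∑ i, ((T i).ancestors (S i)).ncard ≤ ((glue T).ancestors S').ncard := by
  have : ∑ i, ((T i).ancestors (S i)).ncard = Nat.card (Σ i, (T i).ancestors (S i)) := by
    rw [Nat.card_sigma]; rfl
  rw [this]
  let φ : (Σ i, (T i).ancestors (S i)) → (glue T).ancestors S' := fun p =>
    ⟨some ⟨p.1, p.2.1, p.2.2.1⟩, fun h => Option.some_ne_none _ h, by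
      obtain ⟨i, w, hw, v, hv, n, hn⟩ := p
      refine ⟨glueIn T i v, h i ⟨v, hv, rfl⟩, n, ?_⟩
      rw [glue_iterate_glueIn, hn, glueIn_of_ne T i hw]⟩
  refine Nat.card_le_card_of_injective φ ?_
  rintro ⟨i, w, hw⟩ ⟨j, w', hw'⟩ h
  have h1 := Option.some_injective _ (congrArg Subtype.val h)
  simp only [Sigma.mk.injEq] at h1
  obtain ⟨rfl, h1⟩ := h1
  have h2 := congrArg Subtype.val (eq_of_heq h1)
  simp only at h2
  subst h2
  rfl

end Tree
end BranchDepth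

namespace BranchDepth
-- Laminar families and the exponential bound on circuit size
section Laminar

variable {α ι : Type*}

/-- Any two members of the family that meet are nested. -/
def Laminar (A : ι → Set α) : Prop := ∀ a b x, x ∈ A a → x ∈ A b → A a ⊆ A b ∨ A b ⊆ A a

open Classical in
/-- The indices in `L` of the members of the family that meet `X`. -/
noncomputable def hit (A : ι → Set α) (L : Finset ι) (X : Finset α) : Finset ι :=
  {a ∈ L | ∃ x ∈ X, x ∈ A a}

lemma mem_hit {A : ι → Set α} {L : Finset ι} {X : Finset α} {a : ι} :
    a ∈ hit A L X ↔ a ∈ L ∧ ∃ x ∈ X, x ∈ A a := by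
  classical
  simp [hit]

open Classical in
/-- If the numbers of members hit by the subsets of `S` bound a submodular function `r` and the
number of all members is `r S`, then a suitable subfamily has the same property for `C ⊆ S`. -/
lemma exists_subfamily_of_submodular {A : ι → Set α} (hA : Laminar A) {r : Finset α → ℕ}
    (hmono : Monotone r) (hunit : ∀ X y, r (insert y X) ≤ r X + 1)
    (hsub : ∀ X Y, r (X ∪ Y) + r (X ∩ Y) ≤ r X + r Y)
    {S C : Finset α} (hCS : C ⊆ S) {L : Finset ι} (hL : L.card = r S)
    (hr : ∀ X ⊆ S, r X ≤ (hit A L X).card) :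
    ∃ L' ⊆ L, L'.card = r C ∧ ∀ X ⊆ C, r X ≤ (hit A L' X).card := by
  induction hn : (S \ C).card generalizing S L with
  | zero =>
    have : S = C := (Finset.sdiff_eq_empty_iff_subset.1 (Finset.card_eq_zero.1 hn)).antisymm hCS
    subst this
    exact ⟨L, subset_rfl, hL, hr⟩
  | succ n ih =>
    obtain ⟨y, hy⟩ : (S \ C).Nonempty := Finset.card_pos.1 (by omega)
    obtain ⟨hyS, hyC⟩ := Finset.mem_sdiff.1 hy
    have hCy : C ⊆ S.erase y := Finset.subset_erase.2 ⟨hCS, hyC⟩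
    have hcard : (S.erase y \ C).card = n := by
      rw [Finset.erase_sdiff_comm, Finset.card_erase_of_mem hy, hn]; rfl
    have hins : insert y (S.erase y) = S := Finset.insert_erase hyS
    by_cases hrk : r (S.erase y) = r S
    · exact ih hCy (hL.trans hrk.symm) (fun X hX => hr X (hX.trans (Finset.erase_subset _ _))) hcard
    have hrS : r S = r (S.erase y) + 1 := by
      have h1 := hunit (S.erase y) y
      have h2 := hmono (Finset.erase_subset y S)
      rw [hins] at h1
      omega
    -- By submodularity, an element that raises the rank of `S.erase y` raises the rank of each of
    -- its subsets.
    have hstep : ∀ X ⊆ S.erase y, r X + 1 ≤ r (insert y X) := by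
      intro X hX
      have hyX : y ∉ X := fun h => Finset.notMem_erase y S (hX h)
      have h := hsub (insert y X) (S.erase y)
      rw [Finset.insert_union, Finset.union_eq_right.2 hX, hins,
        Finset.insert_inter_of_notMem (Finset.notMem_erase _ _), Finset.inter_eq_left.2 hX] at h
      omega
    have hex : (hit A L {y}).Nonempty := by
      refine Finset.card_pos.1 ?_
      have h1 := hstep ∅ (Finset.empty_subset _)
      have h2 := hr {y} (by simpa using hyS)
      simp only [insert_empty_eq] at h1
      omega
    -- An innermost member through `y` can be dropped: any set that it meets already meets all
    -- members through `y`, so adding `y` raises the rank but not the hit count, which leaves a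
    -- slack of one.
    obtain ⟨a, ha⟩ : ∃ a, Minimal (· ∈ (A '' (hit A L {y} : Set ι))) a :=
      ((Finset.finite_toSet _).image A).exists_minimal (by simpa using hex)
    obtain ⟨⟨a, haL, rfl⟩, hmin⟩ := ha
    rw [Finset.mem_coe, mem_hit] at haL
    obtain ⟨haL, y', hy', hya⟩ := haL
    obtain rfl := Finset.mem_singleton.1 hy'
    have hinner : ∀ b ∈ L, y' ∈ A b → A a ⊆ A b := by
      intro b hb hyb
      rcases hA a b y' hya hyb with h | h
      · exact h
      · exact hmin ⟨b, by rw [Finset.mem_coe, mem_hit]; exact ⟨hb, y', by simp, hyb⟩, rfl⟩ h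
    obtain ⟨L', hL', h'⟩ := ih (L := L.erase a) hCy
      (by rw [Finset.card_erase_of_mem haL]; omega) (by
        intro X hX
        have herase : hit A (L.erase a) X = (hit A L X).erase a := by
          ext b; simp only [mem_hit, Finset.mem_erase, and_assoc]
        rw [herase]
        by_cases haX : a ∈ hit A L X
        · rw [Finset.card_erase_of_mem haX]
          have h1 := hstep X hX
          have h2 := hr (insert y' X) (Finset.insert_subset hyS (hX.trans (Finset.erase_subset _ _)))
          have h3 : hit A L (insert y' X) = hit A L X := by
            ext b
            simp only [mem_hit, Finset.exists_mem_insert]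
            refine and_congr_right fun hb => ⟨?_, .inr⟩
            rintro (h | h)
            · obtain ⟨-, x, hx, hxa⟩ := mem_hit.1 haX
              exact ⟨x, hx, hinner b hb h hxa⟩
            · exact h
          rw [h3] at h2
          omega
        · rw [Finset.erase_eq_of_notMem haX]
          exact hr X (hX.trans (Finset.erase_subset _ _))) hcard
    exact ⟨L', hL'.trans (Finset.erase_subset _ _), h'⟩

/-- Take a member whose trace `S` on `C` is largest. If `S ≠ C`, no member meets both `S` and `C \
S`, so the members number at least `|S| + |C \ S| = |C|`, one too many. -/
lemma exists_mem_subset_of_card_le_hit {A : ι → Set α} (hA : Laminar A) {C : Finset α}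
    {L : Finset ι} (hL : L.card + 1 = C.card) (hC : 2 ≤ C.card)
    (hr : ∀ X ⊂ C, X.card ≤ (hit A L X).card) : ∃ a ∈ L, (C : Set α) ⊆ A a := by
  classical
  obtain ⟨x, hx⟩ : C.Nonempty := Finset.card_pos.1 (by omega)
  have hxC : {x} ⊂ C := by
    refine Finset.ssubset_iff_subset_ne.2 ⟨by simpa using hx, ?_⟩
    rintro rfl
    simp at hC
  obtain ⟨a₀, ha₀⟩ : (hit A L {x}).Nonempty :=
    Finset.card_pos.1 (lt_of_lt_of_le (by simp) (hr _ hxC))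
  obtain ⟨ha₀L, x', hx', hxa₀⟩ := mem_hit.1 ha₀
  obtain rfl := Finset.mem_singleton.1 hx'
  obtain ⟨a, ha, hmax⟩ := (hit A L C).exists_max_image
    (fun a => {z ∈ C | z ∈ A a}.card) ⟨a₀, mem_hit.2 ⟨ha₀L, x', hx, hxa₀⟩⟩
  obtain ⟨haL, z, hz, hza⟩ := mem_hit.1 ha
  refine ⟨a, haL, ?_⟩
  by_contra hCa
  set S : Finset α := {z ∈ C | z ∈ A a} with hS
  obtain ⟨w, hwC, hwa⟩ := Set.not_subset.1 hCa
  have hSC : S ⊆ C := Finset.filter_subset _ _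
  have hSss : S ⊂ C := Finset.ssubset_iff_subset_ne.2 ⟨hSC, fun h => hwa <| by
    have : w ∈ S := h ▸ hwC
    exact (Finset.mem_filter.1 this).2⟩
  have hSne : S.Nonempty := ⟨z, Finset.mem_filter.2 ⟨hz, hza⟩⟩
  have h1 := hr S hSss
  have h2 := hr (C \ S) (Finset.sdiff_ssubset hSC hSne)
  have hdisj : Disjoint (hit A L S) (hit A L (C \ S)) := by
    rw [Finset.disjoint_left]
    intro b hb hb'
    obtain ⟨hbL, p, hp, hpb⟩ := mem_hit.1 hb
    obtain ⟨-, q, hq, hqb⟩ := mem_hit.1 hb'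
    obtain ⟨hqC, hqS⟩ := Finset.mem_sdiff.1 hq
    obtain ⟨hpC, hpa⟩ := Finset.mem_filter.1 hp
    have hqa : q ∉ A a := fun h => hqS (Finset.mem_filter.2 ⟨hqC, h⟩)
    rcases hA a b p hpa hpb with h | h
    -- Here `b` contains `A a` and also `q`, so its trace on `C` is strictly larger.
    · refine absurd (hmax b (mem_hit.2 ⟨hbL, p, hpC, hpb⟩)) (not_le.2 (Finset.card_lt_card ?_))
      refine Finset.ssubset_iff_subset_ne.2
        ⟨Finset.monotone_filter_right _ fun _ _ hu => h hu, fun h' => hqS ?_⟩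
      rw [h']
      exact Finset.mem_filter.2 ⟨hqC, hqb⟩
    · exact hqa (h hqb)
  have h3 : (hit A L S ∪ hit A L (C \ S)).card ≤ L.card :=
    Finset.card_le_card (Finset.union_subset (Finset.filter_subset _ _) (Finset.filter_subset _ _))
  rw [Finset.card_union_of_disjoint hdisj] at h3
  have h4 := Finset.card_sdiff_add_card_eq_card hSC
  omega

open Classical in
/-- A laminar family of depth at most `d` whose numbers of hit members bound the rank function of
a circuit `C`, and which has only as many members as the rank of `C`, forces `|C| ≤ 2 ^ d`. -/
theorem card_le_two_pow_of_laminar {A : ι → Set α} (hA : Laminar A) {d : ℕ} {C : Finset α}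
    {L : Finset ι} (hL : L.card + 1 = C.card) (hr : ∀ X ⊂ C, X.card ≤ (hit A L X).card)
    (hd : ∀ x ∈ C, (hit A L {x}).card ≤ d) : C.card ≤ 2 ^ d := by
  induction d generalizing C L with
  | zero =>
    by_contra! hC
    rw [pow_zero] at hC
    obtain ⟨a, ha, hCa⟩ := exists_mem_subset_of_card_le_hit hA hL hC hr
    obtain ⟨x, hx⟩ : C.Nonempty := Finset.card_pos.1 (by omega)
    have := hd x hx
    have hmem : a ∈ hit A L {x} := mem_hit.2 ⟨ha, x, by simp, hCa hx⟩
    rw [Finset.card_eq_zero.1 (Nat.le_zero.1 this)] at hmem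
    simp at hmem
  | succ d ih =>
    by_cases hC : C.card ≤ 1
    · exact hC.trans Nat.one_le_two_pow
    push Not at hC
    obtain ⟨a, ha, hCa⟩ := exists_mem_subset_of_card_le_hit hA hL hC hr
    have hhit : ∀ X ⊆ C, X.Nonempty → (hit A (L.erase a) X).card + 1 = (hit A L X).card := by
      intro X hX ⟨x, hx⟩
      have herase : hit A (L.erase a) X = (hit A L X).erase a := by
        ext b; simp only [mem_hit, Finset.mem_erase, and_assoc]
      rw [herase, Finset.card_erase_add_one (mem_hit.2 ⟨ha, x, hx, hCa (hX hx)⟩)]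
    have hitmono : ∀ {X Y : Finset α}, X ⊆ Y → (hit A L X).card ≤ (hit A L Y).card := by
      intro X Y h
      refine Finset.card_le_card fun b hb => ?_
      obtain ⟨h1, x, h2, h3⟩ := mem_hit.1 hb
      exact mem_hit.2 ⟨h1, x, h h2, h3⟩
    have hhitC : L.card ≤ (hit A L C).card := by
      obtain ⟨x, hx⟩ : C.Nonempty := Finset.card_pos.1 (by omega)
      have h1 := hr (C.erase x) (Finset.erase_ssubset hx)
      have h2 := hitmono (Finset.erase_subset x C)
      rw [Finset.card_erase_of_mem hx] at h1
      omega
    -- Removing `a` costs every nonempty set one hit, which only hurts the tight sets, those with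
    -- `|X|` hits. If each of them contains a whole part, the remaining members still bound the rank
    -- function `r` of the direct sum of two circuits `D₁` and `D₂`. Its total rank `|C| - 2` is the
    -- number of members left, so the family restricts to `D₁`.
    have key : ∀ D₁ D₂ : Finset α, D₁.Nonempty → D₂.Nonempty → Disjoint D₁ D₂ → D₁ ∪ D₂ = C →
        (∀ X ⊂ C, X.Nonempty → X.card = (hit A L X).card → D₁ ⊆ X ∨ D₂ ⊆ X) →
        D₁.card ≤ 2 ^ d := by
      intro D₁ D₂ hD₁ hD₂ hdisj hun htight
      let r : Finset α → ℕ := fun X =>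
        min (X ∩ D₁).card (D₁.card - 1) + min (X ∩ D₂).card (D₂.card - 1)
      have hp₁ := hD₁.card_pos
      have hp₂ := hD₂.card_pos
      have hcardC : D₁.card + D₂.card = C.card := by
        rw [← hun, Finset.card_union_of_disjoint hdisj]
      have hsplit : ∀ X ⊆ C, (X ∩ D₁).card + (X ∩ D₂).card = X.card := by
        intro X hX
        rw [← Finset.card_union_of_disjoint
          (hdisj.mono Finset.inter_subset_right Finset.inter_subset_right),
          ← Finset.inter_union_distrib_left, hun, Finset.inter_eq_left.2 hX]
      obtain ⟨L', hL', hcard, hr'⟩ := exists_subfamily_of_submodular hA (r := r)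
        (S := C) (C := D₁) (L := L.erase a)
        (by
          intro X Y hXY
          have h1 := Finset.card_le_card (Finset.inter_subset_inter_right (u := D₁) hXY)
          have h2 := Finset.card_le_card (Finset.inter_subset_inter_right (u := D₂) hXY)
          simp only [r]
          omega)
        (by
          intro X y
          by_cases hy : y ∈ D₁
          · have hy' : y ∉ D₂ := Finset.disjoint_left.1 hdisj hy
            have h1 := Finset.card_insert_le y (X ∩ D₁)
            simp only [r]
            rw [Finset.insert_inter_of_mem hy, Finset.insert_inter_of_notMem hy']
            omega
          · by_cases hy' : y ∈ D₂
            · have h1 := Finset.card_insert_le y (X ∩ D₂)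
              simp only [r]
              rw [Finset.insert_inter_of_mem hy', Finset.insert_inter_of_notMem hy]
              omega
            · simp only [r]
              rw [Finset.insert_inter_of_notMem hy', Finset.insert_inter_of_notMem hy]
              omega)
        (by
          intro X Y
          have h : ∀ D : Finset α, min ((X ∪ Y) ∩ D).card (D.card - 1) +
              min (X ∩ Y ∩ D).card (D.card - 1) ≤
              min (X ∩ D).card (D.card - 1) + min (Y ∩ D).card (D.card - 1) := by
            intro D
            rw [Finset.union_inter_distrib_right, Finset.inter_inter_distrib_right]
            have h1 := Finset.card_union_add_card_inter (X ∩ D) (Y ∩ D)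
            have h2 := Finset.card_le_card
              (Finset.inter_subset_left (s₁ := X ∩ D) (s₂ := Y ∩ D))
            have h3 := Finset.card_le_card
              (Finset.inter_subset_right (s₁ := X ∩ D) (s₂ := Y ∩ D))
            omega
          have h1 := h D₁
          have h2 := h D₂
          simp only [r]
          omega)
        (hun ▸ Finset.subset_union_left)
        (by
          have h1 : C ∩ D₁ = D₁ := Finset.inter_eq_right.2 (hun ▸ Finset.subset_union_left)
          have h2 : C ∩ D₂ = D₂ := Finset.inter_eq_right.2 (hun ▸ Finset.subset_union_right)
          rw [Finset.card_erase_of_mem ha]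
          simp only [r, h1, h2]
          omega)
        (by
          intro X hX
          have hs := hsplit X hX
          rcases X.eq_empty_or_nonempty with rfl | hne
          · simp [r]
          have h1 := hhit X hX hne
          by_cases hXC : X = C
          · subst hXC
            have e1 : X ∩ D₁ = D₁ := Finset.inter_eq_right.2 (hun ▸ Finset.subset_union_left)
            have e2 : X ∩ D₂ = D₂ := Finset.inter_eq_right.2 (hun ▸ Finset.subset_union_right)
            simp only [r, e1, e2]
            omega
          have hXss : X ⊂ C := Finset.ssubset_iff_subset_ne.2 ⟨hX, hXC⟩
          have h2 := hr X hXss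
          by_cases ht : X.card = (hit A L X).card
          · rcases htight X hXss hne ht with h | h
            · have e1 : X ∩ D₁ = D₁ := Finset.inter_eq_right.2 h
              rw [e1] at hs
              simp only [r, e1]
              omega
            · have e2 : X ∩ D₂ = D₂ := Finset.inter_eq_right.2 h
              rw [e2] at hs
              simp only [r, e2]
              omega
          · simp only [r]
            omega)
      have hD₁C : D₁ ⊆ C := hun ▸ Finset.subset_union_left
      have hrD : ∀ X ⊆ D₁, r X = min X.card (D₁.card - 1) := by
        intro X hX
        have h1 : X ∩ D₂ = ∅ := Finset.disjoint_iff_inter_eq_empty.1 (hdisj.mono_left hX)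
        simp [r, h1, Finset.inter_eq_left.2 hX]
      refine ih (L := L') ?_ ?_ ?_
      · rw [hcard, hrD _ subset_rfl]
        omega
      · intro X hX
        have h1 := hr' X hX.subset
        have h2 := Finset.card_lt_card hX
        rw [hrD X hX.subset] at h1
        omega
      · intro x hx
        have h1 := hd x (hD₁C hx)
        have h2 := hhit {x} (by simpa using hD₁C hx) (by simp)
        have h3 : (hit A L' {x}).card ≤ (hit A (L.erase a) {x}).card := by
          refine Finset.card_le_card fun b hb => ?_
          obtain ⟨hb, h⟩ := mem_hit.1 hb
          exact mem_hit.2 ⟨hL' hb, h⟩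
        omega
    -- A minimal tight set serves as `D`. For tight `X` with `X ∪ D ≠ C`, uncrossing makes `X ∩ D`
    -- tight, and minimality gives `D ⊆ X`.
    have hsplit : ∃ D ⊂ C, D.Nonempty ∧
        ∀ X ⊂ C, X.Nonempty → X.card = (hit A L X).card → D ⊆ X ∨ C \ D ⊆ X := by
      by_cases hex : ∃ X ⊂ C, X.Nonempty ∧ X.card = (hit A L X).card
      · obtain ⟨D, hD⟩ : ∃ D, Minimal
            (fun X => X ⊂ C ∧ X.Nonempty ∧ X.card = (hit A L X).card) D := by
          refine Set.Finite.exists_minimal (s := {X | X ⊂ C ∧ X.Nonempty ∧ X.card = (hit A L X).card})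
            (Set.Finite.subset C.powerset.finite_toSet fun X hX => ?_) hex
          simpa using hX.1.subset
        obtain ⟨⟨hDC, hDne, hDt⟩, hmin⟩ := hD
        refine ⟨D, hDC, hDne, fun X hX hXne hXt => ?_⟩
        by_cases hXD : X ∪ D = C
        · right
          rw [sdiff_le_iff, sup_comm]
          exact hXD.ge
        left
        have hunC : X ∪ D ⊂ C := Finset.ssubset_iff_subset_ne.2
          ⟨Finset.union_subset hX.subset hDC.subset, hXD⟩
        have h1 := hr _ hunC
        have hU : hit A L (X ∪ D) ⊆ hit A L X ∪ hit A L D := by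
          intro b hb
          obtain ⟨hbL, x, hx, hxb⟩ := mem_hit.1 hb
          rcases Finset.mem_union.1 hx with h | h
          · exact Finset.mem_union_left _ (mem_hit.2 ⟨hbL, x, h, hxb⟩)
          · exact Finset.mem_union_right _ (mem_hit.2 ⟨hbL, x, h, hxb⟩)
        have h2 := Finset.card_le_card hU
        have h3 := Finset.card_union_add_card_inter (hit A L X) (hit A L D)
        have h4 := Finset.card_union_add_card_inter X D
        -- The member `a` meets both sets, so together they hit fewer than `|X| + |D|` members;
        -- hence `X` and `D` cannot be disjoint.
        have hpos : 0 < (hit A L X ∩ hit A L D).card := by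
          obtain ⟨x, hx⟩ := hXne
          obtain ⟨y, hy⟩ := hDne
          exact Finset.card_pos.2 ⟨a, Finset.mem_inter.2
            ⟨mem_hit.2 ⟨ha, x, hx, hCa (hX.subset hx)⟩,
              mem_hit.2 ⟨ha, y, hy, hCa (hDC.subset hy)⟩⟩⟩
        have hne : (X ∩ D).Nonempty := Finset.card_pos.1 (by omega)
        have hI : hit A L (X ∩ D) ⊆ hit A L X ∩ hit A L D := by
          intro b hb
          obtain ⟨hbL, x, hx, hxb⟩ := mem_hit.1 hb
          obtain ⟨hx1, hx2⟩ := Finset.mem_inter.1 hx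
          exact Finset.mem_inter.2 ⟨mem_hit.2 ⟨hbL, x, hx1, hxb⟩, mem_hit.2 ⟨hbL, x, hx2, hxb⟩⟩
        have h5 := Finset.card_le_card hI
        have hIC : X ∩ D ⊂ C := lt_of_le_of_lt Finset.inter_subset_left hX
        have h6 := hr _ hIC
        exact (hmin ⟨hIC, hne, by omega⟩ Finset.inter_subset_right).trans Finset.inter_subset_left
      -- Without tight sets any partition into two nonempty parts works.
      · obtain ⟨x, hx⟩ : C.Nonempty := Finset.card_pos.1 (by omega)
        refine ⟨{x}, Finset.ssubset_iff_subset_ne.2 ⟨by simpa using hx, ?_⟩, by simp,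
          fun X hX h1 h2 => absurd ⟨X, hX, h1, h2⟩ hex⟩
        rintro rfl
        simp at hC
    obtain ⟨D, hDC, hDne, hD⟩ := hsplit
    have hne : (C \ D).Nonempty := Finset.sdiff_nonempty.2 hDC.not_subset
    have h1 := key D (C \ D) hDne hne Finset.disjoint_sdiff
      (Finset.union_sdiff_of_subset hDC.subset) hD
    have h2 := key (C \ D) D hne hDne Finset.sdiff_disjoint
      (Finset.sdiff_union_of_subset hDC.subset) fun X hX h h' => (hD X hX h h').symm
    have h3 := Finset.card_sdiff_add_card_eq_card hDC.subset
    rw [pow_succ]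
    omega

end Laminar
end BranchDepth

namespace BranchDepth

open Set Matroid

variable {α : Type u} {M : Matroid α} {X Y F S C K Q : Set α} {e x : α}

/-- The rank of a set as a natural number. -/
noncomputable def rk (M : Matroid α) (X : Set α) : ℕ := (M.eRk X).toNat

/-! ### Natural-number rank and its behaviour under contraction -/

section Rank

lemma coe_rk (M : Matroid α) [M.RankFinite] (X : Set α) : (rk M X : ℕ∞) = M.eRk X :=
  ENat.natCast_toNat (eRk_ne_top_iff.2 (M.isRkFinite_set X))

lemma eRank_eq_rk (M : Matroid α) [M.RankFinite] : M.eRank = rk M M.E := by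
  rw [coe_rk, eRk_ground]

lemma rk_empty (M : Matroid α) : rk M ∅ = 0 := by simp [rk]

lemma rk_mono [M.RankFinite] (h : X ⊆ Y) : rk M X ≤ rk M Y := by
  rw [← Nat.cast_le (α := ℕ∞), coe_rk, coe_rk]
  exact M.eRk_mono h

lemma rk_inter_add_rk_union_le (M : Matroid α) [M.RankFinite] (X Y : Set α) :
    rk M (X ∩ Y) + rk M (X ∪ Y) ≤ rk M X + rk M Y := by
  rw [← Nat.cast_le (α := ℕ∞)]
  push_cast
  simp only [coe_rk]
  exact M.eRk_inter_add_eRk_union_le X Y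

lemma rk_union_le (M : Matroid α) [M.RankFinite] (X Y : Set α) :
    rk M (X ∪ Y) ≤ rk M X + rk M Y := by
  have := rk_inter_add_rk_union_le M X Y
  omega

lemma rk_insert_le (M : Matroid α) [M.RankFinite] (e : α) (X : Set α) :
    rk M (insert e X) ≤ rk M X + 1 := by
  rw [← Nat.cast_le (α := ℕ∞)]
  push_cast
  simp only [coe_rk]
  exact M.eRk_insert_le_add_one e X

lemma rk_restrict (h : X ⊆ S) : rk (M ↾ S) X = rk M X := by
  rw [rk, rk, restrict_eRk_eq _ h]

lemma mem_closure_of_rk_insert_le [M.RankFinite] (he : e ∈ M.E) (h : rk M (insert e X) ≤ rk M X) :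
    e ∈ M.closure X := by
  by_contra hcl
  have := eRk_insert_eq_add_one ⟨he, hcl⟩
  rw [← coe_rk, ← coe_rk] at this
  norm_cast at this
  omega

lemma _root_.Matroid.Indep.rk_eq_ncard (h : M.Indep X) : rk M X = X.ncard := by
  rw [rk, h.eRk_eq_encard, Set.ncard]

lemma _root_.Matroid.IsCircuit.rk_add_one [M.RankFinite] (h : M.IsCircuit C) :
    rk M C + 1 = C.ncard := by
  have := h.eRk_add_one_eq
  rw [← coe_rk, ← h.finite.cast_ncard_eq] at this
  exact_mod_cast this

lemma indep_of_ncard_le_rk [M.RankFinite] (hX : X.Finite) (h : X.ncard ≤ rk M X) : M.Indep X := by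
  rw [indep_iff_eRk_eq_encard_of_finite hX]
  refine (M.eRk_le_encard X).antisymm ?_
  rw [← coe_rk, ← hX.cast_ncard_eq]
  exact_mod_cast h

end Rank

instance contract_finite [M.Finite] (X : Set α) : (M ／ X).Finite :=
  ⟨M.ground_finite.subset sdiff_subset⟩

lemma rk_contract [M.Finite] (he : M.IsNonloop e) (hX : X ⊆ M.E \ {e}) :
    rk (M ／ {e}) X + 1 = rk M (insert e X) := by
  obtain ⟨J, hJ⟩ := (M ／ {e}).exists_isBasis X
  have hb := (indep_singleton.2 he).union_isBasis_union_of_contract_isBasis hJ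
  have heJ : e ∉ J := fun h => (hX (hJ.subset h)).2 rfl
  have h1 := hb.encard_eq_eRk
  rw [union_singleton, union_singleton, encard_insert_of_notMem heJ, hJ.encard_eq_eRk, ← coe_rk,
    ← coe_rk] at h1
  exact_mod_cast h1

lemma rk_contract_ground [M.Finite] (he : M.IsNonloop e) :
    rk (M ／ {e}) (M ／ {e}).E + 1 = rk M M.E := by
  rw [contract_ground, rk_contract he subset_rfl, insert_sdiff_singleton,
    insert_eq_of_mem he.mem_ground]

/-! ### From depth-decompositions to bounded circuits -/

section DepthDecomposition

lemma isDepthDecomposition_iff [M.Finite] {T : Tree.{u}} {f : α → T.V} :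
    IsDepthDecomposition M T f ↔
      rk M M.E = T.size ∧ ∀ X ⊆ M.E, rk M X ≤ (T.ancestors (f '' X)).ncard := by
  simp only [IsDepthDecomposition, T.encard_edges, T.encard_rootPathEdges, eRank_eq_rk, ← coe_rk,
    Nat.cast_inj, Nat.cast_le]

/-- A matroid with a depth-decomposition of depth `d` has no circuit with more than `2 ^ d`
elements. -/
theorem IsDepthDecomposition.ncard_circuit_le [M.Finite] {T : Tree.{u}} {f : α → T.V}
    (h : IsDepthDecomposition M T f) (hC : M.IsCircuit C) : C.ncard ≤ 2 ^ T.depth := by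
  classical
  obtain ⟨hrank, hle⟩ := isDepthDecomposition_iff.1 h
  have := Fintype.ofFinite T.V
  -- Each edge is represented by its lower end `a`, and `A a` is the set of elements mapped below
  -- it.
  let A : T.V → Set α := fun a => {x | a ∈ T.ancestors {f x}}
  let L : Finset T.V := {v | v ≠ T.root}
  have hA : Laminar A := by
    intro a b x ha hb
    rcases T.ancestors_comparable ha hb with ⟨n, hn⟩ | ⟨n, hn⟩
    · left
      rintro y ⟨-, _, rfl, m, hm⟩
      exact ⟨hb.1, _, rfl, n + m, by rw [Function.iterate_add_apply, hm, hn]⟩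
    · right
      rintro y ⟨-, _, rfl, m, hm⟩
      exact ⟨ha.1, _, rfl, n + m, by rw [Function.iterate_add_apply, hm, hn]⟩
  have hhit : ∀ X : Finset α, (hit A L X).card = (T.ancestors (f '' X)).ncard := by
    intro X
    rw [← Set.ncard_coe_finset]
    congr 1
    ext a
    simp only [Finset.mem_coe, mem_hit, L, A, Tree.ancestors]
    constructor
    · rintro ⟨-, x, hx, h1, _, rfl, n, hn⟩
      exact ⟨h1, _, ⟨x, hx, rfl⟩, n, hn⟩
    · rintro ⟨h1, _, ⟨x, hx, rfl⟩, n, hn⟩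
      exact ⟨by simpa using h1, x, hx, h1, _, rfl, n, hn⟩
  have hsize : L.card = T.size := by
    rw [← Set.ncard_coe_finset]
    simp only [L, Finset.coe_filter, Finset.mem_univ, true_and]
    rfl
  have hCfin := M.set_finite C hC.subset_ground
  obtain ⟨L', hL', hcard, hr⟩ := exists_subfamily_of_submodular hA (r := fun X => rk M X)
    (S := M.ground_finite.toFinset) (C := hCfin.toFinset) (L := L)
    (fun X Y h => rk_mono (by exact_mod_cast h))
    (fun X y => by rw [Finset.coe_insert]; exact rk_insert_le M y X)
    (fun X Y => by
      rw [Finset.coe_union, Finset.coe_inter, add_comm]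
      exact rk_inter_add_rk_union_le M X Y)
    (by simpa using hC.subset_ground)
    (by simpa [hsize] using hrank.symm)
    (fun X hX => by
      rw [hhit]
      exact hle X (by simpa [Finset.subset_iff, Set.subset_def] using hX))
  rw [Finite.coe_toFinset] at hcard
  have hCc : hCfin.toFinset.card = C.ncard := (ncard_eq_toFinset_card C hCfin).symm
  rw [← hCc]
  refine card_le_two_pow_of_laminar hA (L := L') ?_ ?_ ?_
  · rw [hCc, hcard, hC.rk_add_one]
  · intro X hX
    have hXC : (X : Set α) ⊂ C := by
      rw [← hCfin.coe_toFinset]; exact Finset.coe_ssubset.2 hX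
    have h1 := (hC.ssubset_indep hXC).rk_eq_ncard
    rw [ncard_coe_finset] at h1
    rw [← h1]
    exact hr X hX.subset
  · intro x hx
    refine le_trans ?_ (T.ncard_ancestors_singleton_le (f x))
    have h1 := hhit {x}
    rw [Finset.coe_singleton, image_singleton] at h1
    rw [← h1]
    refine Finset.card_le_card fun b hb => ?_
    obtain ⟨hb, h⟩ := mem_hit.1 hb
    exact mem_hit.2 ⟨hL' hb, h⟩

/-- The given decomposition only ensures that the infimum defining `bd` is attained; the infimum of
the empty set would be `0`. -/
lemma ncard_circuit_le_two_pow_bd [M.Finite] {T : Tree.{u}} {f : α → T.V}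
    (h : IsDepthDecomposition M T f) (hC : M.IsCircuit C) : C.ncard ≤ 2 ^ bd M := by
  obtain ⟨T', f', h', hd⟩ := Nat.sInf_mem
    (s := {d | ∃ (T : Tree.{u}) (f : α → T.V), IsDepthDecomposition M T f ∧ T.depth = d})
    ⟨_, T, f, h, rfl⟩
  have := h'.ncard_circuit_le hC
  rwa [hd] at this

end DepthDecomposition

/-! ### Separators, components and circuits through an element -/

section Connectivity

/-- A separator of a matroid: a set `F` with `r(F) + r(E \ F) = r(E)`. -/
def IsSeparator (M : Matroid α) (F : Set α) : Prop :=
  F ⊆ M.E ∧ rk M F + rk M (M.E \ F) = rk M M.E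

lemma isConnected_iff [M.RankFinite] :
    IsConnected M ↔ ∀ F, IsSeparator M F → F = ∅ ∨ F = M.E := by
  simp only [IsConnected, IsSeparator, eRank_eq_rk, ← coe_rk, and_imp]
  norm_cast

lemma IsConnected.rk_lt [M.RankFinite] (h : IsConnected M) (hF : F ⊆ M.E) (hne : F.Nonempty)
    (hne' : (M.E \ F).Nonempty) : rk M M.E < rk M F + rk M (M.E \ F) := by
  have h1 := rk_union_le M F (M.E \ F)
  rw [union_sdiff_cancel hF] at h1
  refine h1.lt_of_ne fun heq => ?_
  rcases isConnected_iff.1 h F ⟨hF, heq.symm⟩ with rfl | rfl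
  · simp at hne
  · simp at hne'

lemma isSeparator_of_le [M.RankFinite] (hF : F ⊆ M.E)
    (h : rk M F + rk M (M.E \ F) ≤ rk M M.E) : IsSeparator M F := by
  have h1 := rk_union_le M F (M.E \ F)
  rw [union_sdiff_cancel hF] at h1
  exact ⟨hF, by omega⟩

/-- Submodularity is applied to `X, S` and then to `X ∪ S, M.E \ S`; the separator equality cancels
the rank of `S`. -/
lemma IsSeparator.rk_inter_add [M.RankFinite] (h : IsSeparator M S) (hX : X ⊆ M.E) :
    rk M (X ∩ S) + rk M (X \ S) = rk M X := by
  have h1 := rk_inter_add_rk_union_le M X S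
  have h2 := rk_inter_add_rk_union_le M (X ∪ S) (M.E \ S)
  have e1 : (X ∪ S) ∩ (M.E \ S) = X \ S := by
    ext y
    have := @hX y
    simp only [mem_inter_iff, mem_union, mem_sdiff]
    tauto
  have e2 : (X ∪ S) ∪ (M.E \ S) = M.E := by
    ext y
    have := @hX y
    have := @h.1 y
    simp only [mem_union, mem_sdiff]
    tauto
  rw [e1, e2] at h2
  have h3 := rk_union_le M (X ∩ S) (X \ S)
  rw [inter_union_sdiff] at h3
  have := h.2
  omega

lemma IsSeparator.compl (h : IsSeparator M S) : IsSeparator M (M.E \ S) := by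
  refine ⟨sdiff_subset, ?_⟩
  rw [sdiff_sdiff_cancel_left h.1, add_comm, h.2]

lemma IsSeparator.subset_or_disjoint [M.RankFinite] (h : IsSeparator M S) (hX : X ⊆ M.E)
    (hc : IsConnected (M ↾ X)) : X ⊆ S ∨ Disjoint X S := by
  rcases isConnected_iff.1 hc (X ∩ S) ⟨inter_subset_left, by
    rw [restrict_ground_eq, rk_restrict inter_subset_left, rk_restrict sdiff_subset,
      rk_restrict subset_rfl, sdiff_self_inter, h.rk_inter_add hX]⟩ with h' | h'
  · exact .inr (disjoint_iff_inter_eq_empty.2 h')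
  · exact .inl (inter_eq_left.1 h')

lemma isConnected_restrict_singleton (M : Matroid α) [M.RankFinite] (x : α) :
    IsConnected (M ↾ {x}) :=
  isConnected_iff.2 fun _ hF => subset_singleton_iff_eq.1 hF.1

lemma exists_isComponent_superset [M.Finite] (hX : X ⊆ M.E) (hne : X.Nonempty)
    (hc : IsConnected (M ↾ X)) : ∃ F, IsComponent M F ∧ X ⊆ F := by
  obtain ⟨F, hXF, hF⟩ := Set.Finite.exists_le_maximal
    (s := {F | F ⊆ M.E ∧ F.Nonempty ∧ IsConnected (M.restrict F)}) (a := X)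
    (M.ground_finite.finite_subsets.subset fun F hF => hF.1) ⟨hX, hne, hc⟩
  exact ⟨F, hF, hXF⟩

lemma exists_isComponent_mem [M.Finite] (hx : x ∈ M.E) : ∃ F, IsComponent M F ∧ x ∈ F := by
  obtain ⟨F, hF, h⟩ := exists_isComponent_superset (singleton_subset_iff.2 hx)
    (singleton_nonempty x) (isConnected_restrict_singleton M x)
  exact ⟨F, hF, h rfl⟩

/-- A minimal separator `S ⊇ F` induces a connected matroid: a separator of `M ↾ S` separates `M`,
and either it or its complement in `S` contains the connected set `F`, so by minimality equals `S`.
Maximality of `F` then gives `S = F`. -/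
lemma IsComponent.isSeparator [M.Finite] (hF : IsComponent M F) : IsSeparator M F := by
  obtain ⟨S, hS⟩ : ∃ S, Minimal (fun S => IsSeparator M S ∧ F ⊆ S) S :=
    Finite.exists_minimal (s := {S | IsSeparator M S ∧ F ⊆ S})
      (M.ground_finite.finite_subsets.subset fun S hS => hS.1.1)
      ⟨M.E, ⟨subset_rfl, by simp [rk_empty]⟩, hF.1.1⟩
  obtain ⟨⟨hSsep, hFS⟩, hmin⟩ := hS
  suffices hconn : IsConnected (M ↾ S) by
    rw [hF.eq_of_subset ⟨hSsep.1, hF.1.2.1.mono hFS, hconn⟩ hFS]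
    exact hSsep
  have key : ∀ R, IsSeparator (M ↾ S) R → IsSeparator M R := by
    intro R hR
    have hRS : R ⊆ S := hR.1
    have h1 := hR.2
    rw [restrict_ground_eq, rk_restrict hRS, rk_restrict sdiff_subset, rk_restrict subset_rfl] at h1
    refine isSeparator_of_le (hRS.trans hSsep.1) ?_
    have h2 := rk_union_le M (S \ R) (M.E \ S)
    have h3 : M.E \ R ⊆ (S \ R) ∪ (M.E \ S) := by
      intro y hy
      simp only [mem_union, mem_sdiff] at hy ⊢
      tauto
    have h4 := rk_mono (M := M) h3
    have := hSsep.2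
    omega
  have key2 : ∀ R, IsSeparator (M ↾ S) R → F ⊆ R → R = S := fun R hR hFR =>
    subset_antisymm hR.1 (hmin ⟨key R hR, hFR⟩ hR.1)
  refine isConnected_iff.2 fun R hR => ?_
  rcases (key R hR).subset_or_disjoint hF.1.1 hF.1.2.2 with h | h
  · exact .inr (key2 R hR h)
  · left
    have := key2 _ hR.compl (subset_sdiff.2 ⟨hFS, h⟩)
    rw [restrict_ground_eq, sdiff_eq_left] at this
    exact disjoint_self.1 (this.mono_left hR.1)

lemma IsComponent.eq_of_not_disjoint [M.Finite] (hF : IsComponent M F) {F' : Set α}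
    (hF' : IsComponent M F') (h : ¬ Disjoint F F') : F = F' :=
  hF.eq_of_subset hF'.1 ((hF'.isSeparator.subset_or_disjoint hF.1.1 hF.1.2.2).resolve_right h)

instance finite_component (M : Matroid α) [M.Finite] : Finite (Component M) :=
  (M.ground_finite.finite_subsets.subset fun (_ : Set α) (hF : IsComponent M _) => hF.1.1).to_subtype

lemma Component.finite_restrict [M.Finite] (F : Component M) : (M ↾ F.1).Finite :=
  restrict_finite (M.set_finite F.1 F.2.1.1)

lemma Component.eq_of_mem [M.Finite] {F F' : Component M} (h : x ∈ F.1) (h' : x ∈ F'.1) :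
    F = F' :=
  Subtype.ext (F.2.eq_of_not_disjoint F'.2 (not_disjoint_iff.2 ⟨x, h, h'⟩))

lemma rk_iUnion_component [M.Finite] (s : Finset (Component M)) :
    rk M (⋃ F ∈ s, F.1) = ∑ F ∈ s, rk M F.1 := by
  classical
  induction s using Finset.induction_on with
  | empty => simp [rk_empty]
  | insert F s hFs ih =>
    rw [Finset.set_biUnion_insert, Finset.sum_insert hFs, ← ih]
    have hsub : (⋃ F' ∈ s, F'.1) ⊆ M.E := iUnion₂_subset fun F' _ => F'.2.1.1
    rw [← F.2.isSeparator.rk_inter_add (union_subset F.2.1.1 hsub), union_inter_cancel_left,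
      union_sdiff_left, sdiff_eq_left.2]
    rw [disjoint_left]
    intro x hx hxF
    obtain ⟨F', hF', hx'⟩ := mem_iUnion₂.1 hx
    exact hFs (Component.eq_of_mem hxF hx' ▸ hF')

lemma rk_ground_eq_sum [M.Finite] [Fintype (Component M)] :
    rk M M.E = ∑ F : Component M, rk M F.1 := by
  rw [← rk_iUnion_component]
  congr 1
  refine subset_antisymm (fun x hx => ?_) (iUnion₂_subset fun F _ => F.2.1.1)
  obtain ⟨F, hF, hxF⟩ := exists_isComponent_mem hx
  exact mem_iUnion₂.2 ⟨⟨F, hF⟩, Finset.mem_univ _, hxF⟩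

lemma rk_le_sum [M.Finite] [Fintype (Component M)] (hX : X ⊆ M.E) :
    rk M X ≤ ∑ F : Component M, rk M (X ∩ F.1) := by
  classical
  have hle : ∀ s : Finset (Component M),
      rk M (⋃ F ∈ s, X ∩ F.1) ≤ ∑ F ∈ s, rk M (X ∩ F.1) := by
    intro s
    induction s using Finset.induction_on with
    | empty => simp [rk_empty]
    | insert F s hFs ih =>
      rw [Finset.set_biUnion_insert, Finset.sum_insert hFs]
      have := rk_union_le M (X ∩ F.1) (⋃ F ∈ s, X ∩ F.1)
      omega
  refine le_trans (rk_mono fun x hx => ?_) (hle Finset.univ)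
  obtain ⟨F, hF, hxF⟩ := exists_isComponent_mem (hX hx)
  exact mem_iUnion₂.2 ⟨⟨F, hF⟩, Finset.mem_univ _, hx, hxF⟩

/-- Two complementary proper parts of a circuit are independent, so their ranks add up to `|C|`
rather than `|C| - 1`. -/
lemma _root_.Matroid.IsCircuit.isConnected_restrict [M.Finite] (hC : M.IsCircuit C) :
    IsConnected (M ↾ C) := by
  refine isConnected_iff.2 fun F ⟨hF, hsep⟩ => ?_
  rw [restrict_ground_eq] at hF hsep ⊢
  rw [rk_restrict hF, rk_restrict sdiff_subset, rk_restrict subset_rfl] at hsep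
  by_contra! hne
  have h1 := (hC.ssubset_indep (hF.ssubset_of_ne hne.2)).rk_eq_ncard
  have hd : C \ F ⊂ C := sdiff_ssubset_left_iff.2 (by rw [inter_eq_right.2 hF]; exact hne.1)
  have h2 := (hC.ssubset_indep hd).rk_eq_ncard
  have h3 := ncard_sdiff_add_ncard_of_subset hF (M.set_finite C hC.subset_ground)
  have h4 := hC.rk_add_one
  omega

lemma _root_.Matroid.IsCircuit.subset_or_disjoint_component [M.Finite] (hC : M.IsCircuit C)
    (hF : IsComponent M F) : C ⊆ F ∨ Disjoint C F :=
  hF.isSeparator.subset_or_disjoint hC.subset_ground hC.isConnected_restrict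

lemma IsConnected.eq_singleton_of_isLoop [M.Finite] (h : IsConnected M) (he : M.IsLoop e) :
    M.E = {e} := by
  have h0 : rk M {e} = 0 := by simp [rk, he.eRk_eq]
  have hsep : IsSeparator M {e} := isSeparator_of_le (singleton_subset_iff.2 he.mem_ground)
    (by rw [h0, zero_add]; exact rk_mono sdiff_subset)
  rcases isConnected_iff.1 h _ hsep with h' | h'
  · simp at h'
  · exact h'.symm

lemma IsConnected.isNonloop [M.Finite] (h : IsConnected M) (hr : 1 ≤ M.eRank) (he : e ∈ M.E) :
    M.IsNonloop e := by
  refine isNonloop_of_not_isLoop he fun hl => ?_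
  have h1 := h.eq_singleton_of_isLoop hl
  rw [← eRk_ground, h1, hl.eRk_eq] at hr
  simp at hr

lemma IsConnected.exists_isCircuit_mem [M.Finite] (h : IsConnected M) (he : e ∈ M.E)
    (hne : M.E ≠ {e}) : ∃ C, M.IsCircuit C ∧ e ∈ C := by
  have hne' : (M.E \ {e}).Nonempty := by
    by_contra h'
    rw [not_nonempty_iff_eq_empty, sdiff_eq_empty] at h'
    exact hne (h'.antisymm (singleton_subset_iff.2 he))
  have h1 := h.rk_lt (singleton_subset_iff.2 he) (singleton_nonempty e) hne'
  have h2 : rk M {e} ≤ 1 := by simpa [rk_empty] using rk_insert_le M e ∅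
  have hcl : e ∈ M.closure (M.E \ {e}) := mem_closure_of_rk_insert_le he (by
    rw [insert_sdiff_singleton, insert_eq_of_mem he]; omega)
  obtain ⟨C, hC, hC', heC⟩ := exists_isCircuit_of_mem_closure hcl (by simp)
  exact ⟨C, hC', heC⟩

/-- Connectivity makes the complement of the parallel class `M.closure {e}` spanning. A circuit
through `e` whose other elements avoid that class has no element parallel to `e`. -/
lemma IsConnected.exists_large_isCircuit [M.Finite] (h : IsConnected M) (hr : 2 ≤ M.eRank)
    (he : e ∈ M.E) : ∃ C, M.IsCircuit C ∧ 3 ≤ C.encard ∧ e ∈ C := by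
  have hnl := h.isNonloop (le_trans (by norm_num) hr) he
  rw [eRank_eq_rk] at hr
  have hr' : 2 ≤ rk M M.E := by exact_mod_cast hr
  have hPE : M.closure {e} ⊆ M.E := M.closure_subset_ground _
  have heP : e ∈ M.closure {e} := M.mem_closure_self e
  have hP1 : rk M (M.closure {e}) = 1 := by rw [rk, eRk_closure_eq, hnl.eRk_eq]; rfl
  have hne : (M.E \ M.closure {e}).Nonempty := by
    by_contra h'
    rw [not_nonempty_iff_eq_empty, sdiff_eq_empty] at h'
    have := rk_mono (M := M) h'
    omega
  have h1 := h.rk_lt hPE ⟨e, heP⟩ hne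
  have hcl : e ∈ M.closure (M.E \ M.closure {e}) := mem_closure_of_rk_insert_le he (by
    have := rk_mono (M := M) (insert_subset he (sdiff_subset (s := M.E) (t := M.closure {e})))
    omega)
  obtain ⟨C, hCsub, hC, heC⟩ := exists_isCircuit_of_mem_closure hcl (fun h' => h'.2 heP)
  refine ⟨C, hC, ?_, heC⟩
  have hCfin := M.set_finite C hC.subset_ground
  rw [← hCfin.cast_ncard_eq]
  by_contra! hlt
  have hlt' : C.ncard < 3 := by exact_mod_cast hlt
  have hne' : (C \ {e}).Nonempty := by
    by_contra h'
    rw [not_nonempty_iff_eq_empty, sdiff_eq_empty] at h'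
    rw [h'.antisymm (singleton_subset_iff.2 heC), singleton_isCircuit] at hC
    exact hC.not_isNonloop hnl
  obtain ⟨x, hxC, hxe⟩ := hne'
  have hsub : C \ {x} ⊆ {e} := by
    have hsub' : {e, x} ⊆ C := insert_subset heC (singleton_subset_iff.2 hxC)
    have hc2 : ({e, x} : Set α).ncard = 2 := ncard_pair (Ne.symm hxe)
    have : ({e, x} : Set α) = C := eq_of_subset_of_ncard_le hsub' (by omega) hCfin
    rw [← this]
    rintro y ⟨rfl | rfl, hy⟩
    · rfl
    · exact absurd rfl hy
  have hx := M.closure_subset_closure hsub (hC.mem_closure_sdiff_singleton_of_mem hxC)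
  rcases hCsub hxC with rfl | h'
  · exact hxe rfl
  · exact h'.2 hx

/-- `F` separates `M / e` but not `M`; comparing the two rank statements forces `r(F ∪ e) ≤ r(F)`,
so `F` spans `e`. -/
lemma IsConnected.exists_isCircuit_of_component [M.Finite] (h : IsConnected M)
    (he : M.IsNonloop e) (hF : IsComponent (M ／ {e}) F) :
    ∃ C, M.IsCircuit C ∧ C ⊆ insert e F ∧ e ∈ C := by
  have hFE : F ⊆ M.E \ {e} := hF.1.1
  have heF : e ∉ F := fun h' => (hFE h').2 rfl
  have hs := hF.isSeparator.2
  have h1 := rk_contract he hFE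
  have h2 := rk_contract he (X := (M.E \ {e}) \ F) sdiff_subset
  have h3 := rk_contract_ground he
  have e1 : insert e ((M.E \ {e}) \ F) = M.E \ F := by
    ext y
    have := he.mem_ground
    by_cases hy : y = e
    · subst hy; simp [this, heF]
    · simp [hy]
  rw [e1] at h2
  rw [contract_ground] at hs h3
  have h4 := h.rk_lt (hFE.trans sdiff_subset) hF.1.2.1 ⟨e, he.mem_ground, heF⟩
  have hcl : e ∈ M.closure F := mem_closure_of_rk_insert_le he.mem_ground (by omega)
  obtain ⟨C, hCsub, hC, heC⟩ := exists_isCircuit_of_mem_closure hcl heF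
  exact ⟨C, hC, hCsub, heC⟩

end Connectivity

/-! ### Ears of circuits -/

section Ears

/-- An ear of a set `C`: an independent set that is a circuit after `C` is contracted. -/
def IsEar (M : Matroid α) (C Q : Set α) : Prop := (M ／ C).IsCircuit Q ∧ M.Indep Q

lemma IsEar.of_contract_restrict {R : Set α} (hR : R ⊆ M.E \ {e}) (he : e ∈ C)
    (hC : C \ {e} ⊆ R) (h : IsEar ((M ／ {e}) ↾ R) (C \ {e}) Q) :
    IsEar M C Q ∧ (M ／ {e}).Indep Q := by
  obtain ⟨h1, h2⟩ := h
  have hsub : R \ (C \ {e}) ⊆ (M ／ C).E := fun y hy =>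
    ⟨(hR hy.1).1, fun hyC => hy.2 ⟨hyC, (hR hy.1).2⟩⟩
  rw [restrict_contract_eq_contract_restrict _ hC, contract_contract, union_sdiff_self,
    union_eq_self_of_subset_left (singleton_subset_iff.2 he), restrict_isCircuit_iff hsub] at h1
  exact ⟨⟨h1.1, h2.of_restrict.of_contract⟩, h2.of_restrict⟩

lemma IsEar.exists_isCircuit_ssuperset (h : IsEar M C Q) :
    ∃ K, M.IsCircuit K ∧ Q ⊂ K ∧ K ⊆ Q ∪ C := by
  obtain ⟨K, hK, hQK, hKQ⟩ := h.1.exists_subset_isCircuit_of_contract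
  exact ⟨K, hK, hQK.ssubset_of_ne fun h' => hK.not_indep (h' ▸ h.2), hKQ⟩

/-- A circuit `K` with `Q ⊂ K ⊆ Q ∪ C` that misses `e` is traded, by strong elimination with `C`,
for one through `e`; its part outside `C` is dependent in `M / C` and inside `Q`, hence all of `Q`.
The surplus is two because `insert e Q` is still independent. -/
lemma IsEar.exists_isCircuit_mem [M.Finite] (hC : M.IsCircuit C) (heC : e ∈ C)
    (h : IsEar M C Q) (hQ : (M ／ {e}).Indep Q) (he : M.IsNonloop e) :
    ∃ K, M.IsCircuit K ∧ e ∈ K ∧ K ⊆ Q ∪ C ∧ Q.ncard + 2 ≤ K.ncard := by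
  have hQC : Disjoint Q C := by
    have := h.1.subset_ground
    exact (subset_sdiff.1 this).2
  obtain ⟨K, hK, hQK, hKQ, heK⟩ : ∃ K, M.IsCircuit K ∧ Q ⊆ K ∧ K ⊆ Q ∪ C ∧ e ∈ K := by
    obtain ⟨K, hK, hQK, hKQ⟩ := h.exists_isCircuit_ssuperset
    by_cases heK : e ∈ K
    · exact ⟨K, hK, hQK.subset, hKQ, heK⟩
    obtain ⟨f, hfK, hfQ⟩ := exists_of_ssubset hQK
    have hfC : f ∈ C := (hKQ hfK).resolve_left hfQ
    obtain ⟨K', hK'sub, hK', heK'⟩ := hC.strong_elimination hK hfC hfK heC heK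
    have hK'C : ¬ K' ⊆ C := by
      intro hsub
      have := hK'.eq_of_subset_isCircuit hC hsub
      exact (hK'sub (this ▸ hfC)).2 rfl
    have hK'Q : K' \ C ⊆ Q := by
      rintro y ⟨hy, hyC⟩
      rcases (hK'sub hy).1 with h' | h'
      · exact absurd h' hyC
      · exact (hKQ h').resolve_right hyC
    have heq := h.1.eq_of_dep_subset (hK'.contract_dep_of_not_subset hK'C) hK'Q
    refine ⟨K', hK', heq ▸ sdiff_subset, fun y hy => ?_, heK'⟩
    by_cases hyC : y ∈ C
    · exact .inr hyC
    · exact .inl (hK'Q ⟨hy, hyC⟩)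
  refine ⟨K, hK, heK, hKQ, ?_⟩
  have heQ : e ∉ Q := fun h' => disjoint_left.1 hQC h' heC
  have hind : M.Indep (insert e Q) := (he.contractElem_indep_iff.1 hQ).2
  have hss : insert e Q ⊂ K := (insert_subset heK hQK).ssubset_of_ne
    fun h' => hK.not_indep (h' ▸ hind)
  have hKfin := M.set_finite K hK.subset_ground
  have := ncard_lt_ncard hss hKfin
  rw [ncard_insert_of_notMem heQ (hKfin.subset hQK)] at this
  omega

lemma IsSeparator.contract_indep [M.Finite] (hF : IsSeparator M F) {I G : Set α} (hI : M.Indep I)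
    (hIF : I ⊆ F) (hG : Disjoint G F) (hGE : G ⊆ M.E) : (M ／ G).Indep I := by
  obtain ⟨J, hJ⟩ := M.exists_isBasis G
  rw [hJ.contract_indep_iff]
  have hJF : Disjoint J F := hG.mono_left hJ.subset
  refine ⟨?_, hG.mono_right hIF⟩
  have hIfin := M.set_finite I hI.subset_ground
  have hJfin := M.set_finite J hJ.indep.subset_ground
  refine indep_of_ncard_le_rk (hIfin.union hJfin) ?_
  rw [← hF.rk_inter_add (union_subset hI.subset_ground hJ.indep.subset_ground)]
  have e1 : (I ∪ J) ∩ F = I := by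
    rw [union_inter_distrib_right, inter_eq_left.2 hIF, hJF.inter_eq, union_empty]
  have e2 : (I ∪ J) \ F = J := by
    rw [union_sdiff_distrib, sdiff_eq_empty.2 hIF, hJF.sdiff_eq_left, empty_union]
  rw [e1, e2, hI.rk_eq_ncard, hJ.indep.rk_eq_ncard]
  exact ncard_union_le _ _

lemma IsSeparator.contract_isCircuit [M.Finite] (hF : IsSeparator M F) (hK : M.IsCircuit K)
    (hKF : K ⊆ F) {G : Set α} (hG : Disjoint G F) (hGE : G ⊆ M.E) : (M ／ G).IsCircuit K := by
  rw [isCircuit_iff_forall_ssubset]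
  exact ⟨hK.contract_dep (hG.mono_right hKF), fun I hI =>
    hF.contract_indep (hK.ssubset_indep hI) (hI.subset.trans hKF) hG hGE⟩

/-- `K \ {e}` is a circuit of `M / e` inside the separator `F`, so contracting `C \ {e}`, which lies
outside `F`, leaves it a circuit. -/
lemma isEar_of_isSeparator [M.Finite] (hF : IsSeparator (M ／ {e}) F) (hK : M.IsCircuit K)
    (hKn : K.Nontrivial) (heK : e ∈ K) (hKF : K \ {e} ⊆ F) (heC : e ∈ C) (hC : C ⊆ M.E)
    (hCF : Disjoint (C \ {e}) F) : IsEar M C (K \ {e}) := by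
  refine ⟨?_, hK.sdiff_singleton_indep heK⟩
  have h1 := hF.contract_isCircuit (hK.contractElem_isCircuit hKn heK) hKF hCF
    (sdiff_subset_sdiff_left hC)
  rwa [contract_contract, union_sdiff_self,
    union_eq_self_of_subset_left (singleton_subset_iff.2 heC)] at h1

lemma isSeparator_of_parallel [M.Finite] (hxe : x ≠ e)
    (hC : M.IsCircuit {e, x}) : IsSeparator (M ／ {e}) ((M.E \ {e}) \ {x}) := by
  have hl : (M ／ {e}).IsLoop x := by
    rw [contract_isLoop_iff_mem_closure]
    refine ⟨?_, hxe⟩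
    have := hC.mem_closure_sdiff_singleton_of_mem (e := x) (by simp)
    rwa [pair_sdiff_right (Ne.symm hxe)] at this
  have h0 : rk (M ／ {e}) {x} = 0 := by simp [rk, hl.eRk_eq]
  refine IsSeparator.compl (M := M ／ {e})
    (isSeparator_of_le (singleton_subset_iff.2 hl.mem_ground) ?_)
  rw [h0, zero_add]
  exact rk_mono sdiff_subset

end Ears
end BranchDepth

namespace BranchDepth

open Set Matroid

variable {α : Type u} {M : Matroid α} {C D : Set α} {e e₁ g : α}

/-- The inputs of the routine other than one-element matroids without circuits. -/
structure IsProperInput (M : Matroid α) (C : Set α) (e : α) : Prop where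
  isConnected : IsConnected M
  isCircuit : M.IsCircuit C
  mem : e ∈ C

/-! ### Proper inputs and their preservation by recursive calls -/

section Inputs

lemma IsInput.isProperInput_or (h : IsInput M C e) : IsProperInput M C e ∨ M.eRank ≤ 1 := by
  rcases h with ⟨hM, ⟨hC, he, -⟩ | h1⟩
  · exact .inl ⟨hM, hC, he⟩
  · exact .inr (h1 ▸ M.eRank_le_encard_ground)

/-- A proper input may have a loop as `e`, since a component of `M / e` can be a single loop; in
positive rank connectivity excludes this. -/
lemma IsProperInput.isNonloop [M.Finite] (h : IsProperInput M C e) (hr : 1 ≤ M.eRank) :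
    M.IsNonloop e :=
  h.isConnected.isNonloop hr (h.isCircuit.subset_ground h.mem)

lemma nontrivial_of_isNonloop_mem (hC : M.IsCircuit C) (he : M.IsNonloop e) (heC : e ∈ C) :
    C.Nontrivial := by
  by_contra h
  rw [not_nontrivial_iff] at h
  rw [h.eq_singleton_of_mem heC, singleton_isCircuit] at hC
  exact hC.not_isNonloop he

lemma one_lt_ncard_iff_of_finite (hC : C.Finite) : 1 < C.ncard ↔ C.Nontrivial :=
  have := hC.to_subtype
  one_lt_ncard_iff_nontrivial

lemma one_le_of_two_le {n : ℕ∞} (h : 2 ≤ n) : 1 ≤ n := le_trans (by norm_num) h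

lemma IsProperInput.step3 [M.Finite] (h : IsProperInput M C e) (hs : Step3 M C e e₁) :
    IsProperInput (M ／ {e}) (C \ {e}) e₁ :=
  ⟨hs.2.2.1, h.isCircuit.contractElem_isCircuit
    (nontrivial_of_isNonloop_mem h.isCircuit (h.isNonloop (one_le_of_two_le hs.1)) h.mem) h.mem,
    hs.2.2.2⟩

lemma Choice45.exists_isCircuit {F : Set α} (h : IsProperInput M C e)
    (hF : Choice45 M C e F D g) :
    ∃ C₁, M.IsCircuit C₁ ∧ e ∈ C₁ ∧ D = C₁ \ {e} ∧ C₁ \ {e} ⊆ F ∧ g ∈ C₁ \ {e} ∧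
      (C₁ = C ∨ Disjoint F C) := by
  rcases hF with ⟨h1, rfl, h2⟩ | ⟨h1, C', hC', hsub, he, rfl, hg⟩
  · exact ⟨C, h.isCircuit, h.mem, rfl, h1, h2, .inl rfl⟩
  · refine ⟨C', hC', he, rfl, ?_, hg, .inr h1⟩
    rintro y ⟨hy, hye⟩
    exact (hsub hy).resolve_left hye

lemma IsProperInput.step45 [M.Finite] (h : IsProperInput M C e) (hs : Step45 M C e)
    (F : Component (M ／ {e})) (hF : Choice45 M C e F.1 D g) :
    IsProperInput ((M ／ {e}) ↾ F.1) D g := by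
  obtain ⟨C₁, hC₁, heC₁, rfl, hsub, hg, -⟩ := hF.exists_isCircuit h
  have hnt := nontrivial_of_isNonloop_mem hC₁ (h.isNonloop (one_le_of_two_le hs.1)) heC₁
  exact ⟨F.2.1.2.2, (hC₁.contractElem_isCircuit hnt heC₁).isCircuit_restrict_of_subset hsub, hg⟩

lemma IsProperInput.exists_choice45 [M.Finite] (h : IsProperInput M C e) (hs : Step45 M C e)
    (F : Component (M ／ {e})) : ∃ D g, Choice45 M C e F.1 D g := by
  have hnl := h.isNonloop (one_le_of_two_le hs.1)
  have hcirc := h.isCircuit.contractElem_isCircuit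
    (nontrivial_of_isNonloop_mem h.isCircuit hnl h.mem) h.mem
  rcases hcirc.subset_or_disjoint_component F.2 with hsub | hdisj
  · obtain ⟨g, hg⟩ := hcirc.nonempty
    exact ⟨_, g, .inl ⟨hsub, rfl, hg⟩⟩
  · have hFC : Disjoint F.1 C := by
      rw [disjoint_left] at hdisj ⊢
      exact fun y hy hyC => hdisj ⟨hyC, (F.2.1.1 hy).2⟩ hy
    obtain ⟨C', hC', hsub, he⟩ := h.isConnected.exists_isCircuit_of_component hnl F.2
    obtain ⟨g, hg⟩ := (hC'.contractElem_isCircuit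
      (nontrivial_of_isNonloop_mem hC' hnl he) he).nonempty
    exact ⟨_, g, .inr ⟨hFC, C', hC', hsub, he, rfl, hg⟩⟩

lemma IsProperInput.exists_step2 [M.Finite] (h : IsProperInput M C e) (hr : 2 ≤ M.eRank)
    (hC : C.encard = 2) : ∃ C', Step2 M C e C' := by
  obtain ⟨C', hC', h3, he⟩ := h.isConnected.exists_large_isCircuit hr
    (h.isCircuit.subset_ground h.mem)
  exact ⟨C', hr, hC, hC', h3, he⟩

lemma IsProperInput.step2 {C' : Set α} (h : IsProperInput M C e) (hs : Step2 M C e C') :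
    IsProperInput M C' e :=
  ⟨h.isConnected, hs.2.2.1, hs.2.2.2.2⟩

lemma ncard_contract_ground_lt [M.Finite] (he : e ∈ M.E) : (M ／ {e}).E.ncard < M.E.ncard :=
  ncard_sdiff_singleton_lt_of_mem he M.ground_finite

lemma ncard_component_contract_lt [M.Finite] (he : e ∈ M.E) (F : Component (M ／ {e})) :
    F.1.ncard < M.E.ncard :=
  (ncard_le_ncard F.2.1.1 (M ／ {e}).ground_finite).trans_lt (ncard_contract_ground_lt he)

lemma encard_ne_two_of_three_le (h : 3 ≤ C.encard) : C.encard ≠ 2 := by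
  intro h'
  rw [h'] at h
  exact absurd h (by norm_num)

end Inputs

/-! ### Termination and existence of outputs -/

section Termination

lemma exists_construct_of_eRank_le_one [M.Finite] (C : Set α) (e : α) (hr : M.eRank ≤ 1) :
    ∃ (T : Tree.{u}) (f : α → T.V), Construct M C e T f := by
  rcases hr.lt_or_eq with hr | hr
  · exact ⟨Tree.single, fun _ => Tree.single.root,
      .step0 M C e _ (Order.lt_one_iff.1 hr) fun _ _ => rfl⟩
  · exact ⟨Tree.single.addRoot, fun _ => some Tree.single.root, .step1 M C e _ hr fun _ _ => rfl⟩

lemma two_le_of_not_le_one {n : ℕ∞} (h : ¬ n ≤ 1) : 2 ≤ n := by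
  rw [not_le] at h
  exact Order.add_one_le_of_lt h

theorem IsProperInput.exists_construct [M.Finite] (h : IsProperInput M C e) :
    ∃ (T : Tree.{u}) (f : α → T.V), Construct M C e T f := by
  classical
  induction hn : M.E.ncard using Nat.strong_induction_on generalizing M C e with
  | _ n ih =>
  subst hn
  by_cases hr : M.eRank ≤ 1
  · exact exists_construct_of_eRank_le_one C e hr
  replace hr := two_le_of_not_le_one hr
  -- The case without Step 2 comes first, because Step 2 keeps the ground set but passes on a
  -- circuit of size at least three.
  have main : ∀ C, IsProperInput M C e → C.encard ≠ 2 →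
      ∃ (T : Tree.{u}) (f : α → T.V), Construct M C e T f := by
    intro C h hC
    have heE := h.isCircuit.subset_ground h.mem
    by_cases hconn : IsConnected (M ／ {e})
    · obtain ⟨e₁, he₁⟩ := (h.isCircuit.contractElem_isCircuit (nontrivial_of_isNonloop_mem
        h.isCircuit (h.isNonloop (one_le_of_two_le hr)) h.mem) h.mem).nonempty
      have hs : Step3 M C e e₁ := ⟨hr, hC, hconn, he₁⟩
      obtain ⟨T, f, hT⟩ := ih _ (ncard_contract_ground_lt heE) (h.step3 hs) rfl
      refine ⟨T.addRoot, fun x => if x = e then some T.root else some (f x),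
        .step3 M C e e₁ T f _ hs hT (if_pos rfl) fun x hx => if_neg hx.2⟩
    · have hs : Step45 M C e := ⟨hr, hC, hconn⟩
      choose D g hD using h.exists_choice45 hs
      have hex : ∀ F : Component (M ／ {e}), ∃ (T : Tree.{u}) (f : α → T.V),
          Construct ((M ／ {e}) ↾ F.1) (D F) (g F) T f := fun F =>
        have := F.finite_restrict
        ih _ (ncard_component_contract_lt heE F) (h.step45 hs F (hD F)) rfl
      choose T f hT using hex
      refine ⟨(Tree.glue T).addRoot,
        -- The default value, the root of the glued tree, is the prescribed image of `e`.
        fun x => if hx : ∃ F : Component (M ／ {e}), x ∈ F.1 then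
          some (Tree.glueIn T hx.choose (f hx.choose x)) else some (Tree.glue T).root,
        .step45 M C e D g T f _ hs hD hT (dif_neg ?_) ?_⟩
      · rintro ⟨F, hF⟩
        exact (F.2.1.1 hF).2 rfl
      · intro F x hx
        have hex : ∃ F : Component (M ／ {e}), x ∈ F.1 := ⟨F, hx⟩
        refine (dif_pos hex).trans ?_
        rw [Component.eq_of_mem hex.choose_spec hx]
        rfl
  by_cases hC : C.encard = 2
  · obtain ⟨C', hs⟩ := h.exists_step2 hr hC
    obtain ⟨T, f, hT⟩ := main C' (h.step2 hs) (encard_ne_two_of_three_le hs.2.2.2.1)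
    exact ⟨T, f, .step2 M C e C' T f hs hT⟩
  · exact main C h hC

lemma acc_of_eRank_le_one [M.Finite] (hr : M.eRank ≤ 1) :
    Acc (fun s' s : Matroid α × Set α × α => Calls s s') (M, C, e) := by
  have h2 : ¬ 2 ≤ M.eRank := fun h => absurd (h.trans hr) (by norm_num)
  constructor
  intro s hs
  cases hs with
  | step2 _ _ _ _ hs => exact absurd hs.1 h2
  | step3 _ _ _ _ hs => exact absurd hs.1 h2
  | step45 _ _ _ _ _ _ hs => exact absurd hs.1 h2

theorem IsProperInput.acc [M.Finite] (h : IsProperInput M C e) :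
    Acc (fun s' s : Matroid α × Set α × α => Calls s s') (M, C, e) := by
  induction hn : M.E.ncard using Nat.strong_induction_on generalizing M C e with
  | _ n ih =>
  subst hn
  have main : ∀ C, IsProperInput M C e → C.encard ≠ 2 →
      Acc (fun s' s : Matroid α × Set α × α => Calls s s') (M, C, e) := by
    intro C h hC
    have heE := h.isCircuit.subset_ground h.mem
    constructor
    intro s hs
    cases hs with
    | step2 _ _ _ _ hs => exact absurd hs.2.1 hC
    | step3 _ _ _ _ hs => exact ih _ (ncard_contract_ground_lt heE) (h.step3 hs) rfl
    | step45 _ _ _ F _ _ hs hD =>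
      have := F.finite_restrict
      exact ih _ (ncard_component_contract_lt heE F) (h.step45 hs F hD) rfl
  by_cases hC : C.encard = 2
  · constructor
    intro s hs
    cases hs with
    | step2 _ _ _ C' hs => exact main C' (h.step2 hs) (encard_ne_two_of_three_le hs.2.2.2.1)
    | step3 _ _ _ _ hs => exact absurd hC hs.2.1
    | step45 _ _ _ _ _ _ hs => exact absurd hC hs.2.1
  · exact main C h hC

lemma IsProperInput.of_reachable [M.Finite] (h : IsProperInput M C e)
    {s : Matroid α × Set α × α} (hs : Relation.ReflTransGen Calls (M, C, e) s) :
    s.1.Finite ∧ IsProperInput s.1 s.2.1 s.2.2 := by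
  induction hs with
  | refl => exact ⟨inferInstance, h⟩
  | tail _ hcall ih =>
    obtain ⟨hfin, hp⟩ := ih
    cases hcall with
    | step2 _ _ _ _ hs => exact ⟨hfin, hp.step2 hs⟩
    | step3 _ _ _ _ hs => exact ⟨contract_finite _, hp.step3 hs⟩
    | step45 _ _ _ F _ _ hs hD => exact ⟨F.finite_restrict, hp.step45 hs F hD⟩

theorem IsInput.alwaysReturns [M.Finite] (h : IsInput M C e) : AlwaysReturns M C e := by
  rcases h.isProperInput_or with h | h
  · refine ⟨h.acc, fun s hs => ?_⟩
    obtain ⟨_, hp⟩ := h.of_reachable hs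
    exact hp.exists_construct
  · refine ⟨acc_of_eRank_le_one h, fun s hs => ?_⟩
    rcases Relation.ReflTransGen.cases_head hs with rfl | ⟨t, ht, -⟩
    · exact exists_construct_of_eRank_le_one _ _ h
    · have h2 : ¬ 2 ≤ M.eRank := fun h' => absurd (h'.trans h) (by norm_num)
      cases ht with
      | step2 _ _ _ _ hs => exact absurd hs.1 h2
      | step3 _ _ _ _ hs => exact absurd hs.1 h2
      | step45 _ _ _ _ _ _ hs => exact absurd hs.1 h2

theorem exists_constructAll (M : Matroid α) [M.Finite] :
    ∃ (T : Tree.{u}) (f : α → T.V), ConstructAll M T f := by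
  classical
  have hin : ∀ F : Component M, ∃ (C : Set α) (e : α), IsInput (M ↾ F.1) C e := by
    intro F
    have := F.finite_restrict
    have hconn : IsConnected (M ↾ F.1) := F.2.1.2.2
    obtain ⟨e, he⟩ := F.2.1.2.1
    by_cases hF : F.1 = {e}
    · exact ⟨∅, e, hconn, .inr (by rw [restrict_ground_eq, hF, encard_singleton])⟩
    · obtain ⟨C, hC, heC⟩ := hconn.exists_isCircuit_mem he hF
      refine ⟨C, e, hconn, .inl ⟨hC, heC, isNonloop_of_not_isLoop he fun hl => ?_⟩⟩
      exact hF (hconn.eq_singleton_of_isLoop hl)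
  choose C e hin using hin
  have hex : ∀ F : Component M, ∃ (T : Tree.{u}) (f : α → T.V),
      Construct (M ↾ F.1) (C F) (e F) T f := fun F =>
    have := F.finite_restrict
    (hin F).alwaysReturns.2 _ .refl
  choose T f hT using hex
  refine ⟨Tree.glue T, fun x => if hx : ∃ F : Component M, x ∈ F.1 then
    Tree.glueIn T hx.choose (f hx.choose x) else (Tree.glue T).root,
    .mk M C e T f _ hin hT ?_⟩
  intro F x hx
  have hex : ∃ F : Component M, x ∈ F.1 := ⟨F, hx⟩
  refine (dif_pos hex).trans ?_
  rw [Component.eq_of_mem hex.choose_spec hx]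

end Termination

/-! ### The returned pair is a depth-decomposition -/

section Decomposition

lemma IsDepthDecomposition.glue [M.Finite] [Finite (Component M)] {T : Component M → Tree.{u}}
    {h : ∀ F, α → (T F).V} {f : α → (Tree.glue T).V}
    (hd : ∀ F, IsDepthDecomposition (M ↾ F.1) (T F) (h F))
    (hf : ∀ F, ∀ x ∈ F.1, f x = Tree.glueIn T F (h F x)) :
    IsDepthDecomposition M (Tree.glue T) f := by
  have := Fintype.ofFinite (Component M)
  have hd' := fun F : Component M =>
    have := F.finite_restrict
    isDepthDecomposition_iff.1 (hd F)
  refine isDepthDecomposition_iff.2 ⟨?_, fun X hX => (rk_le_sum hX).trans ?_⟩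
  · rw [rk_ground_eq_sum, Tree.size_glue]
    refine Finset.sum_congr rfl fun F _ => ?_
    rw [← (hd' F).1, restrict_ground_eq, rk_restrict subset_rfl]
  · refine le_trans (Finset.sum_le_sum fun F _ => ?_) (Tree.sum_ncard_ancestors_le_glue T
      (fun F => h F '' (X ∩ F.1)) (S' := f '' X) fun F => ?_)
    · rw [← rk_restrict (M := M) (S := F.1) inter_subset_right]
      exact (hd' F).2 _ inter_subset_right
    · rintro _ ⟨_, ⟨x, hx, rfl⟩, rfl⟩
      exact ⟨x, hx.1, hf F x hx.2⟩

lemma IsDepthDecomposition.addRoot [M.Finite] (he : M.IsNonloop e) {T : Tree.{u}} {f' : α → T.V}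
    (hd : IsDepthDecomposition (M ／ {e}) T f') {f : α → T.addRoot.V}
    (hfe : f e = some T.root) (hf : ∀ x ∈ M.E \ {e}, f x = some (f' x)) :
    IsDepthDecomposition M T.addRoot f := by
  obtain ⟨h1, h2⟩ := isDepthDecomposition_iff.1 hd
  refine isDepthDecomposition_iff.2 ⟨?_, fun X hX => ?_⟩
  · rw [Tree.size_addRoot, ← h1, rk_contract_ground he]
  rcases X.eq_empty_or_nonempty with rfl | ⟨x, hx⟩
  · simp [rk_empty]
  have hsub : X \ {e} ⊆ M.E \ {e} := sdiff_subset_sdiff_left hX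
  have h3 := h2 (X \ {e}) hsub
  have h4 := rk_contract he hsub
  have h5 : rk M X ≤ rk M (insert e (X \ {e})) := rk_mono (by
    rw [insert_sdiff_singleton]; exact subset_insert _ _)
  have hS : {w : T.V | (some w : Option T.V) ∈ f '' X}.Nonempty := by
    by_cases hxe : x = e
    · exact ⟨T.root, x, hx, hxe ▸ hfe⟩
    · exact ⟨f' x, x, hx, hf x ⟨hX hx, hxe⟩⟩
  have h6 := T.ncard_ancestors_addRoot hS (S' := f '' X) (by rintro _ ⟨w, hw, rfl⟩; exact hw)
  have h7 : (T.ancestors (f' '' (X \ {e}))).ncard ≤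
      (T.ancestors {w : T.V | (some w : Option T.V) ∈ f '' X}).ncard := by
    refine ncard_le_ncard ?_
    rintro w ⟨hw, _, ⟨y, hy, rfl⟩, hn⟩
    exact ⟨hw, f' y, ⟨y, hy.1, hf y (hsub hy)⟩, hn⟩
  omega

theorem Construct.isDepthDecomposition {T : Tree.{u}} {f : α → T.V} (h : Construct M C e T f)
    (hM : M.Finite) (hp : 2 ≤ M.eRank → IsProperInput M C e) : IsDepthDecomposition M T f := by
  induction h with
  | step0 M C e f hr hf =>
    rw [eRank_eq_rk] at hr
    have hr' : rk M M.E = 0 := by exact_mod_cast hr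
    refine isDepthDecomposition_iff.2 ⟨by rw [Tree.size_single, hr'], fun X hX => ?_⟩
    have := rk_mono (M := M) hX
    omega
  | step1 M C e f hr hf =>
    rw [eRank_eq_rk] at hr
    have hr' : rk M M.E = 1 := by exact_mod_cast hr
    refine isDepthDecomposition_iff.2
      ⟨by rw [Tree.size_addRoot, Tree.size_single, hr'], fun X hX => ?_⟩
    rcases X.eq_empty_or_nonempty with rfl | ⟨x, hx⟩
    · simp [rk_empty]
    have h1 := Tree.single.ncard_ancestors_addRoot (S := {Tree.single.root})
      (singleton_nonempty _) (S' := f '' X) (by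
        rintro _ ⟨w, rfl, rfl⟩
        exact ⟨x, hx, hf x (hX hx)⟩)
    have := rk_mono (M := M) hX
    omega
  | step2 M C e C' T f hs hc ih => exact ih hM fun hr => (hp hr).step2 hs
  | step3 M C e e₁ T' f' f hs hc hfe hf ih =>
    have hp := hp hs.1
    exact (ih (contract_finite _) fun _ => hp.step3 hs).addRoot
      (hp.isNonloop (one_le_of_two_le hs.1)) hfe hf
  | step45 M C e D g T h f hs hD hc hfe hf ih =>
    have hp := hp hs.1
    -- Undoes the added root; on `M.E \ {e}` the default value is never used.
    let f' : α → (Tree.glue T).V := fun x => Option.getD (f x) (Tree.glue T).root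
    have hglue : IsDepthDecomposition (M ／ {e}) (Tree.glue T) f' :=
      IsDepthDecomposition.glue (fun F => ih F F.finite_restrict fun _ => hp.step45 hs F (hD F))
        fun F x hx => by simp only [f', hf F x hx]; rfl
    refine hglue.addRoot (hp.isNonloop (one_le_of_two_le hs.1)) hfe fun x hx => ?_
    obtain ⟨F, hF, hxF⟩ := exists_isComponent_mem (M := M ／ {e}) hx
    simp only [f', hf ⟨F, hF⟩ x hxF]
    rfl

end Decomposition

/-! ### The quadratic depth bound -/

section Depth

lemma ncard_le_of_contract_restrict [M.Finite] {R K : Set α} {n : ℕ} (hR : R ⊆ M.E \ {e})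
    (hn : ∀ K, M.IsCircuit K → K.ncard ≤ n) (hK : ((M ／ {e}) ↾ R).IsCircuit K) : K.ncard ≤ n := by
  rw [restrict_isCircuit_iff hR] at hK
  obtain ⟨K', hK', hsub, -⟩ := hK.1.exists_subset_isCircuit_of_contract
  exact (ncard_le_ncard hsub (M.set_finite K' hK'.subset_ground)).trans (hn K' hK')

/-- The bound on the depth of a tree returned for the circuit `C`: its excess over `|C| - 1` is
accounted for by an ear of `C`. -/
def EarBound (M : Matroid α) (C : Set α) (n d : ℕ) : Prop :=
  d + 1 ≤ C.ncard ∨ ∃ Q, IsEar M C Q ∧ d + 1 ≤ C.ncard + Q.ncard * (n - 2)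

lemma EarBound.of_contract_restrict {R : Set α} {n d d' : ℕ} [M.Finite] (hR : R ⊆ M.E \ {e})
    (he : e ∈ C) (hC : M.IsCircuit C) (hCR : C \ {e} ⊆ R) (hd : d ≤ d' + 1)
    (h : EarBound ((M ／ {e}) ↾ R) (C \ {e}) n d') : EarBound M C n d := by
  have h1 := ncard_sdiff_singleton_add_one he (M.set_finite C hC.subset_ground)
  rcases h with h | ⟨Q, hQ, h⟩
  · exact .inl (by omega)
  · exact .inr ⟨Q, (hQ.of_contract_restrict hR he hCR).1, by omega⟩

/-- In the first case `K = C`. Otherwise the ear is absorbed into `K` with `|Q| + 2 ≤ |K|`, so `K`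
has two elements only in the first case, where `d ≤ 1`. -/
lemma EarBound.exists_isCircuit [M.Finite] {R : Set α} {n d d' : ℕ} (hR : R ⊆ M.E \ {e})
    (he : e ∈ C) (hC : M.IsCircuit C) (hCR : C \ {e} ⊆ R) (hnl : M.IsNonloop e) (hd : d ≤ d' + 1)
    (hn : ∀ K, M.IsCircuit K → K.ncard ≤ n) (h : EarBound ((M ／ {e}) ↾ R) (C \ {e}) n d') :
    ∃ K, M.IsCircuit K ∧ e ∈ K ∧ K \ {e} ⊆ R ∧ 2 ≤ K.ncard ∧
      d + 1 ≤ n + (K.ncard - 2) * (n - 2) ∧ (K.ncard = 2 → d ≤ 1) := by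
  have hCfin := M.set_finite C hC.subset_ground
  have h1 := ncard_sdiff_singleton_add_one he hCfin
  have h2 := hn C hC
  rcases h with h | ⟨Q, hQ, h⟩
  · have h3 : 1 < C.ncard := (one_lt_ncard_iff_of_finite hCfin).2
      (nontrivial_of_isNonloop_mem hC hnl he)
    exact ⟨C, hC, he, hCR, h3, le_trans (by omega) (Nat.le_add_right _ _), by omega⟩
  · have hQR : Q ⊆ R := hQ.2.subset_ground
    obtain ⟨hQ1, hQ2⟩ := hQ.of_contract_restrict hR he hCR
    obtain ⟨K, hK, heK, hKQ, hcard⟩ := hQ1.exists_isCircuit_mem hC he hQ2 hnl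
    have hQpos : 0 < Q.ncard := (ncard_pos (M.set_finite Q hQ1.2.subset_ground)).2 hQ1.1.nonempty
    refine ⟨K, hK, heK, ?_, by omega, ?_, by omega⟩
    · rintro y ⟨hy, hye⟩
      rcases hKQ hy with h' | h'
      · exact hQR h'
      · exact hCR ⟨h', hye⟩
    · have : Q.ncard * (n - 2) ≤ (K.ncard - 2) * (n - 2) := Nat.mul_le_mul_right _ (by omega)
      omega

/-- Writing `n = 2 + (n - 2)` trades one factor `n - 2` for the gain in passing from `k - 2` to `k -
1`; this is why the ear weight is `n - 2`. -/
lemma add_mul_le_of_le {n k c d : ℕ} (hn : 2 ≤ n) (hk : 2 ≤ k) (hc : 2 ≤ c)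
    (h : d + 1 ≤ n + (k - 2) * (n - 2)) : d + 1 ≤ c + (k - 1) * (n - 2) := by
  obtain ⟨n, rfl⟩ := Nat.exists_eq_add_of_le' hn
  obtain ⟨k, rfl⟩ := Nat.exists_eq_add_of_le' hk
  simp only [Nat.add_sub_cancel, show k + 2 - 1 = k + 1 by omega, add_mul] at h ⊢
  omega

lemma EarBound.of_isSeparator [M.Finite] {F K : Set α} {n d : ℕ} (hn : 2 ≤ n)
    (hF : IsSeparator (M ／ {e}) F) (hK : M.IsCircuit K) (heK : e ∈ K) (hKF : K \ {e} ⊆ F)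
    (h2 : 2 ≤ K.ncard) (hd : d + 1 ≤ n + (K.ncard - 2) * (n - 2)) (heC : e ∈ C) (hC : C ⊆ M.E)
    (hc : 2 ≤ C.ncard) (hCF : Disjoint (C \ {e}) F) : EarBound M C n d := by
  have hKfin := M.set_finite K hK.subset_ground
  refine .inr ⟨K \ {e}, isEar_of_isSeparator hF hK
    ((one_lt_ncard_iff_of_finite hKfin).1 h2) heK hKF heC hC hCF, ?_⟩
  rw [ncard_sdiff_singleton_of_mem heK]
  exact add_mul_le_of_le hn h2 hc hd

/-- The second claim discards `C` in favour of a circuit through `e`: it is what Step 2, which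
replaces the circuit but keeps `e`, needs from its recursive call. -/
theorem Construct.earBound {T : Tree.{u}} {f : α → T.V} (h : Construct M C e T f)
    (hM : M.Finite) (hp : IsProperInput M C e) {n : ℕ} (hn : ∀ K, M.IsCircuit K → K.ncard ≤ n) :
    EarBound M C n T.depth ∧ (3 ≤ C.ncard → ∃ K, M.IsCircuit K ∧ e ∈ K ∧ 3 ≤ K.ncard ∧
      T.depth + 1 ≤ n + (K.ncard - 2) * (n - 2)) := by
  have two_le : ∀ (M : Matroid α) (C : Set α) (e : α), M.Finite → IsProperInput M C e →
      1 ≤ M.eRank → 2 ≤ C.ncard := fun M C e _ hp hr =>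
    (one_lt_ncard_iff_of_finite (M.set_finite C hp.isCircuit.subset_ground)).2
      (nontrivial_of_isNonloop_mem hp.isCircuit (hp.isNonloop hr) hp.mem)
  induction h with
  | step0 M C e f hr hf =>
    rw [Tree.depth_single]
    have := (ncard_pos (M.set_finite C hp.isCircuit.subset_ground)).2 hp.isCircuit.nonempty
    have hCn := hn C hp.isCircuit
    exact ⟨.inl this, fun h3 => ⟨C, hp.isCircuit, hp.mem, h3, by omega⟩⟩
  | step1 M C e f hr hf =>
    have h1 := Tree.single.{u}.depth_addRoot_le
    rw [Tree.depth_single] at h1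
    have h2 := two_le M C e hM hp hr.ge
    have hCn := hn C hp.isCircuit
    exact ⟨.inl (by omega), fun h3 => ⟨C, hp.isCircuit, hp.mem, h3, by omega⟩⟩
  | step2 M C e C' T f hs hc ih =>
    have hCfin := M.set_finite C hp.isCircuit.subset_ground
    have hC2 : C.ncard = 2 := by
      have := hs.2.1
      rw [← hCfin.cast_ncard_eq] at this
      exact_mod_cast this
    have hC'3 : 3 ≤ C'.ncard := by
      have := hs.2.2.2.1
      rw [← (M.set_finite C' hs.2.2.1.subset_ground).cast_ncard_eq] at this
      exact_mod_cast this
    refine ⟨?_, by omega⟩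
    obtain ⟨K, hK, heK, hK3, hd⟩ := (ih hM (hp.step2 hs) hn).2 hC'3
    obtain ⟨x, hx⟩ := ncard_eq_one.1
      (show (C \ {e}).ncard = 1 by rw [ncard_sdiff_singleton_of_mem hp.mem, hC2])
    have hxe : x ≠ e := (hx.ge rfl).2
    have hCeq : C = {e, x} := by
      rw [← insert_sdiff_self_of_mem hp.mem, hx]
    have hxK : x ∉ K := by
      intro hxK
      have hsub : C ⊆ K := hCeq ▸ insert_subset heK (singleton_subset_iff.2 hxK)
      rw [hp.isCircuit.eq_of_subset_isCircuit hK hsub] at hC2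
      omega
    -- The other element of `C` is a loop of `M / e` outside `K`, so `K \ {e}` lies in a separator
    -- disjoint from `C \ {e}`.
    refine EarBound.of_isSeparator (by have := hn K hK; omega)
      (isSeparator_of_parallel hxe (hCeq ▸ hp.isCircuit)) hK heK ?_ (by omega) hd hp.mem
      hp.isCircuit.subset_ground hC2.ge ?_
    · rintro y ⟨hy, hye⟩
      exact ⟨⟨hK.subset_ground hy, hye⟩, fun h' => hxK (h' ▸ hy)⟩
    · rw [hx]
      exact disjoint_sdiff_right
  | step3 M C e e₁ T' f' f hs hc hfe hf ih =>
    have hnl := hp.isNonloop (one_le_of_two_le hs.1)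
    have heq : (M ／ {e}) ↾ (M.E \ {e}) = M ／ {e} := restrict_ground_eq_self _
    have hCR : C \ {e} ⊆ M.E \ {e} := sdiff_subset_sdiff_left hp.isCircuit.subset_ground
    obtain ⟨hB, -⟩ := ih (contract_finite _) (hp.step3 hs) fun K hK =>
      ncard_le_of_contract_restrict (e := e) subset_rfl hn (heq.symm ▸ hK)
    rw [← heq] at hB
    refine ⟨hB.of_contract_restrict subset_rfl hp.mem hp.isCircuit hCR T'.depth_addRoot_le,
      fun h3 => ?_⟩
    obtain ⟨K, hK, heK, -, h2, hd, hd2⟩ := hB.exists_isCircuit subset_rfl hp.mem hp.isCircuit hCR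
      hnl T'.depth_addRoot_le hn
    by_cases hK2 : K.ncard = 2
    · have := hn C hp.isCircuit
      have := hd2 hK2
      exact ⟨C, hp.isCircuit, hp.mem, h3, by omega⟩
    · exact ⟨K, hK, heK, by omega, hd⟩
  | step45 M C e D g T h f hs hD hc hfe hf ih =>
    have hnl := hp.isNonloop (one_le_of_two_le hs.1)
    have hCc := two_le M C e hM hp (one_le_of_two_le hs.1)
    have hne : Nonempty (Component (M ／ {e})) := by
      obtain ⟨x, hx⟩ := (hp.isCircuit.contractElem_isCircuit
        (nontrivial_of_isNonloop_mem hp.isCircuit hnl hp.mem) hp.mem).nonempty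
      obtain ⟨F, hF, -⟩ := exists_isComponent_mem (M := M ／ {e}) (x := x)
        ⟨hp.isCircuit.subset_ground hx.1, hx.2⟩
      exact ⟨⟨F, hF⟩⟩
    -- Gluing at the roots takes the maximum of the depths, so only a deepest component matters.
    obtain ⟨F, hF⟩ := Finite.exists_max fun F => (T F).depth
    have hdepth : (Tree.glue T).addRoot.depth ≤ (T F).depth + 1 :=
      (Tree.depth_addRoot_le _).trans (Nat.succ_le_succ (Tree.depth_glue_le T hF))
    have hFE : F.1 ⊆ M.E \ {e} := F.2.1.1
    obtain ⟨hB, -⟩ := ih F F.finite_restrict (hp.step45 hs F (hD F)) fun K hK =>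
      ncard_le_of_contract_restrict hFE hn hK
    obtain ⟨C₁, hC₁, heC₁, hDeq, hsub, -, hor⟩ := (hD F).exists_isCircuit hp
    rw [hDeq] at hB
    obtain ⟨K, hK, heK, hKF, h2, hd, hd2⟩ := hB.exists_isCircuit hFE heC₁ hC₁ hsub hnl hdepth hn
    have hKn := hn K hK
    refine ⟨?_, fun h3 => ?_⟩
    · rcases hor with rfl | hor
      · exact hB.of_contract_restrict hFE heC₁ hC₁ hsub hdepth
      -- The component avoids `C`, so the circuit `K` found through it yields a single ear of `C`
      -- carrying the whole excess.
      · exact EarBound.of_isSeparator (by omega) F.2.isSeparator hK heK hKF h2 hd hp.mem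
          hp.isCircuit.subset_ground hCc (hor.symm.mono_left sdiff_subset)
    · by_cases hK2 : K.ncard = 2
      · have := hn C hp.isCircuit
        have := hd2 hK2
        exact ⟨C, hp.isCircuit, hp.mem, h3, by omega⟩
      · exact ⟨K, hK, heK, by omega, hd⟩

lemma EarBound.le_sq [M.Finite] {n d : ℕ} (h : EarBound M C n d) (hC : M.IsCircuit C)
    (hn : ∀ K, M.IsCircuit K → K.ncard ≤ n) : d ≤ n ^ 2 := by
  have hCn := hn C hC
  rcases h with h | ⟨Q, hQ, h⟩
  · nlinarith
  · obtain ⟨K, hK, hQK, -⟩ := hQ.exists_isCircuit_ssuperset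
    have h1 := ncard_lt_ncard hQK (M.set_finite K hK.subset_ground)
    have h2 := hn K hK
    have hQpos : 0 < Q.ncard := (ncard_pos (M.set_finite Q hQ.2.subset_ground)).2 hQ.1.nonempty
    have h3 : Q.ncard * (n - 2) ≤ n * (n - 2) := Nat.mul_le_mul_right _ (by omega)
    obtain ⟨n, rfl⟩ := Nat.exists_eq_add_of_le' (show 2 ≤ n by omega)
    rw [Nat.add_sub_cancel] at h h3
    nlinarith

lemma Construct.depth_le_one {T : Tree.{u}} {f : α → T.V} (h : Construct M C e T f)
    (hr : M.eRank ≤ 1) : T.depth ≤ 1 := by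
  have h2 : ¬ 2 ≤ M.eRank := fun h => absurd (h.trans hr) (by norm_num)
  cases h with
  | step0 => rw [Tree.depth_single]; exact Nat.zero_le _
  | step1 => exact Tree.single.depth_addRoot_le.trans (by rw [Tree.depth_single])
  | step2 _ _ _ _ _ _ hs => exact absurd hs.1 h2
  | step3 _ _ _ _ _ _ _ hs => exact absurd hs.1 h2
  | step45 _ _ _ _ _ _ _ _ hs => exact absurd hs.1 h2

lemma Construct.depth_le_sq [M.Finite] {T : Tree.{u}} {f : α → T.V} (h : Construct M C e T f)
    (hi : IsInput M C e) {n : ℕ} (hn : ∀ K, M.IsCircuit K → K.ncard ≤ n) (hn1 : 1 ≤ n) :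
    T.depth ≤ n ^ 2 := by
  rcases hi.isProperInput_or with hp | hr
  · exact (h.earBound inferInstance hp hn).1.le_sq hp.isCircuit hn
  · exact (h.depth_le_one hr).trans (Nat.one_le_pow _ _ hn1)

lemma IsInput.isProperInput (hi : IsInput M C e) (hr : 2 ≤ M.eRank) : IsProperInput M C e :=
  hi.isProperInput_or.resolve_right fun h => absurd (hr.trans h) (by norm_num)

lemma two_pow_sq (n : ℕ) : (2 ^ n) ^ 2 = 4 ^ n := by
  rw [← pow_mul, mul_comm, pow_mul]; norm_num

end Depth

end BranchDepth

open BranchDepth in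
theorem lemmal {α : Type u} (M : Matroid α) [M.Finite] :
    (∀ (C : Set α) (e : α), BranchDepth.IsInput M C e →
      BranchDepth.AlwaysReturns M C e ∧
      ∀ (T : BranchDepth.Tree.{u}) (f : α → T.V), BranchDepth.Construct M C e T f →
        BranchDepth.IsDepthDecomposition M T f ∧ T.depth ≤ 4 ^ BranchDepth.bd M) ∧
    ((∃ (T : BranchDepth.Tree.{u}) (f : α → T.V), BranchDepth.ConstructAll M T f) ∧
      ∀ (T : BranchDepth.Tree.{u}) (f : α → T.V), BranchDepth.ConstructAll M T f →
        BranchDepth.IsDepthDecomposition M T f ∧ T.depth ≤ 4 ^ BranchDepth.bd M) := by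
  refine ⟨fun C e hi => ⟨hi.alwaysReturns, fun T f h => ?_⟩, exists_constructAll M, ?_⟩
  · have hd := h.isDepthDecomposition inferInstance hi.isProperInput
    refine ⟨hd, ?_⟩
    rw [← two_pow_sq]
    exact h.depth_le_sq hi (fun K hK => ncard_circuit_le_two_pow_bd hd hK) Nat.one_le_two_pow
  · intro T f h
    cases h with
    | mk C e T t f hi hc hf =>
    -- Circuits of components are circuits of `M`, so the decomposition of `M` itself bounds them in
    -- terms of `bd M`; branch-depths of components are not needed.
    have hd : IsDepthDecomposition M (Tree.glue T) f := IsDepthDecomposition.glue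
      (fun F => (hc F).isDepthDecomposition F.finite_restrict (hi F).isProperInput) hf
    refine ⟨hd, Tree.depth_glue_le T fun F => ?_⟩
    have := F.finite_restrict
    rw [← two_pow_sq]
    refine (hc F).depth_le_sq (hi F) (fun K hK => ncard_circuit_le_two_pow_bd hd ?_)
      Nat.one_le_two_pow
    exact ((Matroid.restrict_isCircuit_iff F.2.1.1).1 hK).1
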